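/- Function spaces and the energy. Elements of $H^1(\mathbb{R})$ and $W^{1,\infty}(\mathbb{R})$ are identified with their continuous representatives; subscripts $x$, $\xi$ denote weak derivatives; $\|f\|_{H^1}^2=\|f\|_{L^2}^2+\|f_x\|_{L^2}^2$. Let $V=\{f\in C(\mathbb{R})\cap L^\infty(\mathbb{R}) : f_\xi\in L^2(\mathbb{R})\}$ with $\|f\|_V=\|f\|_{L^\infty}+\|f_\xi\|_{L^2}$, and $E=V\times H^1(\mathbb{R})\times V$ with $\|(\zeta,U,H)\|=\|\zeta\|_V+\|U\|_{H^1}+\|H\|_V$. Lagrangian coordinates. A triple $X=(y,U,H)$ of functions on $\mathbb{R}$ is identified with $(\zeta,U,H)$, where $\zeta(\xi)=y(\xi)-\xi$; so $\|X_\alpha-X_\beta\|$ is the $E$-norm of the difference of the corresponding triples $(\zeta,U,H)$. Let $\mathcal{G}$ be the set of $X$ with $(\zeta,U,H)\in E\cap[W^{1,\infty}(\mathbb{R})]^3$ such that $y_\xi\ge 0$, $H_\xi\ge0$, $y_\xi+H_\xi>0$ and $y_\xi H_\xi=y_\xi^2U^2+U_\xi^2$ almost everywhere, and $\lim_{\xi\to-\infty}H(\xi)=0$.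 Let $G$ be the set of homeomorphisms $f$ of $\mathbb{R}$ such that $f-\mathrm{id}$ and $f^{-1}-\mathrm{id}$ belong to $W^{1,\infty}(\mathbb{R})$ and $f_\xi-1\in L^2(\mathbb{R})$; for $\kappa\ge0$ let $G_\kappa$ be the set of $f\in G$ with $\|f-\mathrm{id}\|_{W^{1,\infty}}+\|f^{-1}-\mathrm{id}\|_{W^{1,\infty}}\le\kappa$, where $\|f\|_{W^{1,\infty}}=\|f\|_{L^\infty}+\|f_\xi\|_{L^\infty}$. Let $\mathcal{F}_\kappa=\{X\in\mathcal{G} : y+H\in G_\kappa\}$; in particular $\mathcal{F}_0=\{X\in\mathcal{G} : y+H=\mathrm{id}\}$. With $X\circ f=(y\circ f,U\circ f,H\circ f)$, put $$J(X_\alpha,X_\beta)=\inf_{f_1,f_2\in G}\bigl(\|X_\alpha\circ f_1-X_\beta\|+\|X_\alpha-X_\beta\circ f_2\|\bigr),\qquad d(X_\alpha,X_\beta)=\inf\sum_{n=1}^N J(X_{n-1},X_n)$$ for $X_\alpha,X_\beta\in\mathcal{F}_0$, the last infimum being over all finite sequences $X_0,\dots,X_N$ in $\mathcal{F}_0$ with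 $X_0=X_\alpha$ and $X_N=X_\beta$. Eulerian coordinates. Let $\mathcal{D}$ be the set of pairs $(u,\mu)$ with $u\in H^1(\mathbb{R})$ and $\mu$ a positive finite Radon measure on $\mathbb{R}$ whose absolutely continuous part is $(u^2+u_x^2)\,dx$. For $(u,\mu)\in\mathcal{D}$ let $L(u,\mu)=(y,U,H)$ with $$y(\xi)=\sup\{x\in\mathbb{R} : \mu((-\infty,x))+x<\xi\},\qquad H(\xi)=\xi-y(\xi),\qquad U=u\circ y,$$ and let $d_{\mathcal{D}}(p,q)=d(L(p),L(q))$. Proposition. For every $u\in H^1(\mathbb{R})$ one has $(u,(u^2+u_x^2)\,dx)\in\mathcal{D}$ and $L(u,(u^2+u_x^2)\,dx)\in\mathcal{F}_0$, and the mapping $u\mapsto(u,(u^2+u_x^2)\,dx)$ is continuous from $H^1(\mathbb{R})$ into $(\mathcal{D},d_{\mathcal{D}})$: if $u_n\to u$ in $H^1(\mathbb{R})$, then $$d_{\mathcal{D}}\bigl((u_n,(u_n^2+u_{n,x}^2)\,dx),(u,(u^2+u_x^2)\,dx)\bigr)\to0 .$$ Moreover, $L(u_n,(u_n^2+u_{n,x}^2)\,dx)\to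 L(u,(u^2+u_x^2)\,dx)$ in $E$. -/

import Mathlib

open MeasureTheory Filter Topology
open scoped ENNReal NNReal ContDiff

noncomputable section

namespace CamassaHolm

/-! ### Weak derivatives and function spaces on the real line -/

/-- `g` is a weak derivative of `f` on `ℝ`. -/
def HasWeakDeriv (f g : ℝ → ℝ) : Prop :=
  LocallyIntegrable f volume ∧ LocallyIntegrable g volume ∧
    ∀ φ : ℝ → ℝ, ContDiff ℝ ∞ φ → HasCompactSupport φ →
      ∫ x, f x * deriv φ x = -∫ x, g x * φ x

open Classical in
/-- A weak derivative of `f` (unique up to null sets); it is used only where one exists. -/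
def weakDeriv (f : ℝ → ℝ) : ℝ → ℝ :=
  if h : ∃ g, HasWeakDeriv f g then h.choose else 0

/-- `f` belongs to `H¹(ℝ)`; elements of `H¹(ℝ)` are identified with their continuous
representatives. -/
def MemH1 (f : ℝ → ℝ) : Prop :=
  Continuous f ∧ MemLp f 2 volume ∧ ∃ g, HasWeakDeriv f g ∧ MemLp g 2 volume

/-- `f` belongs to `V = {f ∈ C_b(ℝ) | f_ξ ∈ L²(ℝ)}`. -/
def MemV (f : ℝ → ℝ) : Prop :=
  Continuous f ∧ MemLp f ∞ volume ∧ ∃ g, HasWeakDeriv f g ∧ MemLp g 2 volume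

/-- `f` belongs to `W^{1,∞}(ℝ)`, where again the continuous representative is taken. -/
def MemW1Inf (f : ℝ → ℝ) : Prop :=
  Continuous f ∧ MemLp f ∞ volume ∧ ∃ g, HasWeakDeriv f g ∧ MemLp g ∞ volume

open Classical in
/-- The norm `(‖f‖²_{L²} + ‖f_x‖²_{L²})^{1/2}` of `H¹(ℝ)`, extended by `∞` outside `H¹(ℝ)`. -/
def h1Norm (f : ℝ → ℝ) : ℝ≥0∞ :=
  if MemH1 f then
    (eLpNorm f 2 volume ^ 2 + eLpNorm (weakDeriv f) 2 volume ^ 2) ^ (1 / 2 : ℝ)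
  else ∞

open Classical in
/-- The norm `‖f‖_{L^∞} + ‖f_ξ‖_{L²}` of `V`, extended by `∞` outside `V`. -/
def vNorm (f : ℝ → ℝ) : ℝ≥0∞ :=
  if MemV f then eLpNorm f ∞ volume + eLpNorm (weakDeriv f) 2 volume else ∞

open Classical in
/-- The norm `‖f‖_{L^∞} + ‖f_ξ‖_{L^∞}` of `W^{1,∞}(ℝ)`, extended by `∞` outside `W^{1,∞}(ℝ)`. -/
def w1InfNorm (f : ℝ → ℝ) : ℝ≥0∞ :=
  if MemW1Inf f then eLpNorm f ∞ volume + eLpNorm (weakDeriv f) ∞ volume else ∞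

/-! ### Lagrangian coordinates -/

/-- A triple `X = (y, U, H)` of functions on the real line. -/
structure Lag where
  y : ℝ → ℝ
  U : ℝ → ℝ
  H : ℝ → ℝ

namespace Lag

/-- `ζ(ξ) = y(ξ) - ξ`. -/
def zeta (X : Lag) : ℝ → ℝ := fun ξ => X.y ξ - ξ

/-- Relabeling `X ∘ f = (y ∘ f, U ∘ f, H ∘ f)`. -/
def comp (X : Lag) (f : ℝ → ℝ) : Lag := ⟨X.y ∘ f, X.U ∘ f, X.H ∘ f⟩

/-- `(ζ, U, H)` belongs to `E = V × H¹(ℝ) × V`. -/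
def MemE (X : Lag) : Prop := MemV X.zeta ∧ MemH1 X.U ∧ MemV X.H

end Lag

/-- The distance `‖X - Y‖` given by the norm `‖ζ‖_V + ‖U‖_{H¹} + ‖H‖_V` of `E`. -/
def distE (X Y : Lag) : ℝ≥0∞ :=
  vNorm (fun ξ => X.zeta ξ - Y.zeta ξ) + h1Norm (fun ξ => X.U ξ - Y.U ξ) +
    vNorm (fun ξ => X.H ξ - Y.H ξ)

/-- The set `𝒢` of Lagrangian coordinates. -/
def setG : Set Lag :=
  {X | X.MemE ∧ MemW1Inf X.zeta ∧ MemW1Inf X.U ∧ MemW1Inf X.H ∧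
    (∀ᵐ ξ, 0 ≤ weakDeriv X.y ξ ∧ 0 ≤ weakDeriv X.H ξ ∧
      0 < weakDeriv X.y ξ + weakDeriv X.H ξ) ∧
    Tendsto X.H atBot (𝓝 0) ∧
    ∀ᵐ ξ, weakDeriv X.y ξ * weakDeriv X.H ξ =
      weakDeriv X.y ξ ^ 2 * X.U ξ ^ 2 + weakDeriv X.U ξ ^ 2}

/-- The group `G` of relabeling functions, as a set of homeomorphisms of `ℝ`. -/
def relabelings : Set (ℝ ≃ₜ ℝ) :=
  {f | MemW1Inf (fun ξ => f ξ - ξ) ∧ MemW1Inf (fun ξ => f.symm ξ - ξ) ∧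
    MemLp (fun ξ => weakDeriv f ξ - 1) 2 volume}

/-- The subset `G_κ` of `G`. -/
def relabelingsBdd (κ : ℝ≥0) : Set (ℝ ≃ₜ ℝ) :=
  {f | f ∈ relabelings ∧
    w1InfNorm (fun ξ => f ξ - ξ) + w1InfNorm (fun ξ => f.symm ξ - ξ) ≤ κ}

/-- `ℱ_κ = {X = (y, U, H) ∈ 𝒢 | y + H ∈ G_κ}`. -/
def setF (κ : ℝ≥0) : Set Lag :=
  {X | X ∈ setG ∧ ∃ f ∈ relabelingsBdd κ, ∀ ξ, f ξ = X.y ξ + X.H ξ}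

/-- `J(X, Y) = inf_{f₁, f₂ ∈ G} (‖X ∘ f₁ - Y‖ + ‖X - Y ∘ f₂‖)`. -/
def J (X Y : Lag) : ℝ≥0∞ :=
  ⨅ f₁ ∈ relabelings, ⨅ f₂ ∈ relabelings, distE (X.comp f₁) Y + distE X (Y.comp f₂)

/-- `d(X, Y)`, the infimum of `∑_{n=1}^N J(X_{n-1}, X_n)` over all finite chains in `ℱ₀` from
`X` to `Y` (it is `∞` if there is no such chain, that is, if `X` or `Y` is not in `ℱ₀`). -/
def dLag (X Y : Lag) : ℝ≥0∞ :=
  ⨅ (N : ℕ) (Z : ℕ → Lag) (_ : (∀ n ≤ N, Z n ∈ setF 0) ∧ Z 0 = X ∧ Z N = Y),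
    ∑ n ∈ Finset.range N, J (Z n) (Z (n + 1))

/-! ### Eulerian coordinates -/

/-- The measure `(u² + u_x²) dx`. -/
def energyMeasure (u : ℝ → ℝ) : Measure ℝ :=
  volume.withDensity fun x => ENNReal.ofReal (u x ^ 2 + weakDeriv u x ^ 2)

/-- The set `𝒟` of pairs `(u, μ)`, with `u ∈ H¹(ℝ)` and `μ` a positive finite Radon measure whose
absolutely continuous part is `(u² + u_x²) dx`. -/
def setD : Set ((ℝ → ℝ) × Measure ℝ) :=
  {p | MemH1 p.1 ∧ IsFiniteMeasure p.2 ∧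
    volume.withDensity (p.2.rnDeriv volume) = energyMeasure p.1}

/-- The map `L` from Eulerian to Lagrangian coordinates:
`y(ξ) = sup {x | μ((-∞, x)) + x < ξ}`, `U = u ∘ y`, `H(ξ) = ξ - y(ξ)`. -/
def lagMap (p : (ℝ → ℝ) × Measure ℝ) : Lag :=
  let y : ℝ → ℝ := fun ξ => sSup {x : ℝ | p.2.real (Set.Iio x) + x < ξ}
  ⟨y, p.1 ∘ y, fun ξ => ξ - y ξ⟩

/-- The metric `d_𝒟(p, q) = d(L p, L q)`. -/
def dD (p q : (ℝ → ℝ) × Measure ℝ) : ℝ≥0∞ := dLag (lagMap p) (lagMap q)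

end CamassaHolm

end

noncomputable section

namespace CamassaHolm

/-! ### Weak derivatives and primitives -/

/-! For an absolutely continuous energy with density `g = u² + u_x²`, the label `x + ∫_{-∞}^x g` is
an increasing bijection of the line that does not contract distances. Its inverse `y` is therefore
1-Lipschitz, with `y_ξ = 1 / (1 + g ∘ y)`, and it pushes Lebesgue measure to `(1 + g) dx`
(`map_positionOf`). Membership in `ℱ₀` then amounts to `y + H = id` and the identity `q (1 - q) = q²
g` for `q = 1 / (1 + g)`.

For continuity, identity relabelings and a one-step chain bound `d` by twice the `E`-distance, so
convergence in `E` suffices. Convergence in `H¹` gives `g_n → g` in `L¹`, and `|y_n - y| ≤ ‖g_n -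
g‖_{L¹}` everywhere. The derivatives `y_ξ` and `U_ξ = (u_x ∘ y) y_ξ` contain functions that are
merely measurable, composed with moving maps. They are handled by approximating the limit `g` or
`u_x` by a continuous compactly supported `k`. The approximation errors stay small uniformly in `n`,
because the weight `y_ξ` cancels the density `1 + g` and composition becomes a contraction
(`eLpNorm_comp_mul_stretchOf_le`).

The `L²` norm of `U_n - U` carries no such weight. It is split into `(u_n - v) ∘ y_n`, controlled by
the Sobolev bound and the bounded total energy, and `v ∘ y_n - v ∘ y`, which is a small displacement
of the `H¹` function `v ∘ y`. -/

theorem intervalIntegrable_of_locallyIntegrable {g : ℝ → ℝ} (hg : LocallyIntegrable g volume)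
    (a b : ℝ) : IntervalIntegrable g volume a b :=
  intervalIntegrable_iff.mpr <|
    (hg.integrableOn_isCompact isCompact_uIcc).mono_set Set.uIoc_subset_uIcc

theorem eq_primitive_of_sub_eq_integral {f g : ℝ → ℝ} (h : ∀ a b, f b - f a = ∫ x in a..b, g x)
    (a : ℝ) : f = fun x => f a + ∫ t in a..x, g t := by
  funext x; rw [← h a x]; ring

theorem continuous_of_sub_eq_integral {f g : ℝ → ℝ} (hg : LocallyIntegrable g volume)
    (h : ∀ a b, f b - f a = ∫ x in a..b, g x) : Continuous f := by
  rw [eq_primitive_of_sub_eq_integral h 0]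
  exact continuous_const.add
    (intervalIntegral.continuous_primitive (intervalIntegrable_of_locallyIntegrable hg) 0)

/-- Integration by parts for absolutely continuous functions on an interval containing the support
of the test function; Lebesgue differentiation identifies `deriv f` with `g` almost everywhere. -/
theorem HasWeakDeriv.of_sub_eq_integral {f g : ℝ → ℝ} (hg : LocallyIntegrable g volume)
    (h : ∀ a b, f b - f a = ∫ x in a..b, g x) : HasWeakDeriv f g := by
  have hfc := continuous_of_sub_eq_integral hg h
  refine ⟨hfc.locallyIntegrable, hg, fun φ hφ hφc => ?_⟩
  obtain ⟨R, hR⟩ := hφc.isCompact.isBounded.subset_closedBall 0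
  rw [Real.closedBall_eq_Icc, zero_sub, zero_add] at hR
  -- Strictly larger than `R` and positive: the boundary terms at `±S` vanish and the support fits
  -- in the half-open interval.
  set S := max R 0 + 1 with hS
  have hSR : R < S := by have := le_max_left R 0; linarith
  have hS0 : 0 < S := by have := le_max_right R 0; linarith
  have hsupp : tsupport φ ⊆ Set.Ioc (-S) S := fun x hx =>
    ⟨by have := (hR hx).1; linarith, (hR hx).2.trans hSR.le⟩
  have hφR : ∀ x, R < |x| → φ x = 0 := fun x hx => image_eq_zero_of_notMem_tsupport fun hx' => by
    have := abs_le.2 ⟨(hR hx').1, (hR hx').2⟩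
    linarith
  have hf_ac : AbsolutelyContinuousOnInterval f (-S) S := by
    have h1 := (intervalIntegrable_of_locallyIntegrable hg (-S) S
      ).absolutelyContinuousOnInterval_intervalIntegral (c := -S) (by simp)
    have h2 : AbsolutelyContinuousOnInterval (fun _ : ℝ => f (-S)) (-S) S :=
      (LipschitzWith.const (f (-S))).lipschitzOnWith.absolutelyContinuousOnInterval
    rw [eq_primitive_of_sub_eq_integral h (-S)]
    exact h2.add h1
  have hφ1 : ContDiff ℝ 1 φ := hφ.of_le (by exact_mod_cast le_top)
  have hφ_ac : AbsolutelyContinuousOnInterval φ (-S) S :=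
    hφ1.contDiffOn.absolutelyContinuousOnInterval
  have key := hf_ac.integral_mul_deriv_eq_deriv_mul hφ_ac
  rw [hφR S (by rw [abs_of_pos hS0]; exact hSR),
    hφR (-S) (by rw [abs_neg, abs_of_pos hS0]; exact hSR)] at key
  rw [← intervalIntegral.integral_eq_integral_of_support_subset (a := -S) (b := S)
      (f := fun x => f x * deriv φ x),
    ← intervalIntegral.integral_eq_integral_of_support_subset (a := -S) (b := S)
      (f := fun x => g x * φ x), key]
  · have : ∫ x in (-S)..S, deriv f x * φ x = ∫ x in (-S)..S, g x * φ x := by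
      apply intervalIntegral.integral_congr_ae
      filter_upwards [_root_.LocallyIntegrable.ae_hasDerivAt_integral hg] with x hx _
      have : HasDerivAt f (g x) x := by
        rw [eq_primitive_of_sub_eq_integral h 0]
        exact (hx 0).const_add _
      rw [this.deriv]
    rw [this]; ring
  · exact fun x hx => hsupp (subset_tsupport _ (right_ne_zero_of_mul hx))
  · exact fun x hx => hsupp (tsupport_deriv_subset
      (subset_tsupport _ (right_ne_zero_of_mul hx)))

theorem HasWeakDeriv.ae_eq {f g g' : ℝ → ℝ} (h : HasWeakDeriv f g) (h' : HasWeakDeriv f g') :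
    g =ᵐ[volume] g' := by
  refine ae_eq_of_integral_contDiff_smul_eq h.2.1 h'.2.1 fun φ hφ hφc => ?_
  have h1 := h.2.2 φ hφ hφc
  have h2 := h'.2.2 φ hφ hφc
  simp only [smul_eq_mul, mul_comm (φ _)]
  linarith

theorem HasWeakDeriv.weakDeriv_ae_eq {f g : ℝ → ℝ} (h : HasWeakDeriv f g) :
    weakDeriv f =ᵐ[volume] g := by
  have hex : ∃ g, HasWeakDeriv f g := ⟨g, h⟩
  have : HasWeakDeriv f (weakDeriv f) := by
    rw [weakDeriv, dif_pos hex]; exact hex.choose_spec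
  exact this.ae_eq h

theorem HasWeakDeriv.congr {f g g' : ℝ → ℝ} (h : HasWeakDeriv f g) (hg : g =ᵐ[volume] g') :
    HasWeakDeriv f g' := by
  refine ⟨h.1, h.2.1.congr hg, fun φ hφ hφc => ?_⟩
  rw [h.2.2 φ hφ hφc]
  congr 1
  exact integral_congr_ae (hg.mono fun x hx => by simp only [hx])

theorem integrable_mul_of_locallyIntegrable {f φ : ℝ → ℝ} (hf : LocallyIntegrable f volume)
    (hφ : Continuous φ) (hφc : HasCompactSupport φ) : Integrable (fun x => f x * φ x) := by
  simpa [mul_comm] using hf.integrable_smul_left_of_hasCompactSupport hφ hφc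

theorem HasWeakDeriv.sub {f₁ g₁ f₂ g₂ : ℝ → ℝ} (h₁ : HasWeakDeriv f₁ g₁)
    (h₂ : HasWeakDeriv f₂ g₂) :
    HasWeakDeriv (fun x => f₁ x - f₂ x) (fun x => g₁ x - g₂ x) := by
  refine ⟨h₁.1.sub h₂.1, h₁.2.1.sub h₂.2.1, fun φ hφ hφc => ?_⟩
  have hd : Continuous (deriv φ) := hφ.continuous_deriv (by exact_mod_cast le_top)
  simp only [sub_mul]
  rw [integral_sub (integrable_mul_of_locallyIntegrable h₁.1 hd hφc.deriv)
      (integrable_mul_of_locallyIntegrable h₂.1 hd hφc.deriv),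
    integral_sub (integrable_mul_of_locallyIntegrable h₁.2.1 hφ.continuous hφc)
      (integrable_mul_of_locallyIntegrable h₂.2.1 hφ.continuous hφc),
    h₁.2.2 φ hφ hφc, h₂.2.2 φ hφ hφc]
  ring

open scoped Convolution in
-- Mollify: the derivative of each mollification falls on the bump and pairs `f` with the derivative
-- of a test function, so it vanishes. Each mollification is constant, and they converge pointwise
-- to the continuous `f`.
theorem HasWeakDeriv.eq_of_zero {f : ℝ → ℝ} (hf : Continuous f)
    (h : HasWeakDeriv f (fun _ => 0)) (x y : ℝ) : f x = f y := by
  let φ : ℕ → ContDiffBump (0 : ℝ) := fun n =>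
    ⟨1 / ((n : ℝ) + 1) / 2, 1 / ((n : ℝ) + 1), by positivity, half_lt_self (by positivity)⟩
  have hφ : Tendsto (fun n => (φ n).rOut) atTop (𝓝 0) := tendsto_one_div_add_atTop_nhds_zero_nat
  have hlim := fun z => ContDiffBump.convolution_tendsto_right_of_continuous
    (μ := (volume : Measure ℝ)) hφ hf z
  have hconst : ∀ n, ((φ n).normed volume ⋆[ContinuousLinearMap.lsmul ℝ ℝ, volume] f) x =
      ((φ n).normed volume ⋆[ContinuousLinearMap.lsmul ℝ ℝ, volume] f) y := by
    intro n
    have hder := fun z => ((φ n).hasCompactSupport_normed (μ := volume)).hasDerivAt_convolution_left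
      (ContinuousLinearMap.lsmul ℝ ℝ) (μ := volume) ((φ n).contDiff_normed (μ := volume)) hf.locallyIntegrable z
    refine is_const_of_deriv_eq_zero (fun z => (hder z).differentiableAt) (fun z => ?_) x y
    rw [(hder z).deriv, ← convolution_flip, convolution_def]
    have hs : ContDiff ℝ ∞ (fun t => (φ n).normed volume (z - t)) :=
      ((φ n).contDiff_normed).comp (contDiff_const.sub contDiff_id)
    have hc : HasCompactSupport (fun t => (φ n).normed volume (z - t)) :=
      (φ n).hasCompactSupport_normed.comp_homeomorph (Homeomorph.subLeft z)
    have := h.2.2 _ hs hc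
    simp only [zero_mul, integral_zero, neg_zero, deriv_comp_const_sub, mul_neg, integral_neg,
      neg_eq_zero] at this
    simpa [mul_comm] using this
  exact tendsto_nhds_unique ((hlim x).congr hconst) (hlim y)

theorem HasWeakDeriv.sub_eq_integral {f g : ℝ → ℝ} (hf : Continuous f) (h : HasWeakDeriv f g)
    (a b : ℝ) : f b - f a = ∫ x in a..b, g x := by
  have hI := intervalIntegrable_of_locallyIntegrable h.2.1
  let p : ℝ → ℝ := fun x => ∫ t in (0 : ℝ)..x, g t
  have hp : ∀ a b, p b - p a = ∫ x in a..b, g x := fun a b =>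
    intervalIntegral.integral_interval_sub_left (hI _ _) (hI _ _)
  have h0 := h.sub (HasWeakDeriv.of_sub_eq_integral h.2.1 hp)
  simp only [sub_self] at h0
  have := HasWeakDeriv.eq_of_zero (hf.sub (continuous_of_sub_eq_integral h.2.1 hp)) h0 a b
  simp only [Pi.sub_apply] at this
  rw [← hp a b]
  linarith

/-! ### The change of variables defined by an energy density -/

/-- The Lagrangian label `x + ∫_{-∞}^x g` of the position `x`, for the energy density `g`. -/
def labelOf (g : ℝ → ℝ) (x : ℝ) : ℝ := (∫ t in Set.Iic x, g t) + x

/-- The position of the particle with a given label, for the energy density `g`. -/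
def positionOf (g : ℝ → ℝ) (ξ : ℝ) : ℝ := sSup {x : ℝ | labelOf g x < ξ}

/-- The derivative `1 / (1 + g ∘ y)` of `y = positionOf g`. -/
def stretchOf (g : ℝ → ℝ) (ξ : ℝ) : ℝ := (1 + g (positionOf g ξ))⁻¹

/-- A measurable, nonnegative and integrable function. -/
structure IsEnergyDensity (g : ℝ → ℝ) : Prop where
  measurable : Measurable g
  nonneg : ∀ x, 0 ≤ g x
  integrable : Integrable g volume

namespace IsEnergyDensity

variable {g : ℝ → ℝ} (hg : IsEnergyDensity g)

include hg

theorem one_add_pos (x : ℝ) : 0 < 1 + g x := by have := hg.nonneg x; linarith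

theorem labelOf_sub (a b : ℝ) : labelOf g b - labelOf g a = (∫ t in a..b, g t) + (b - a) := by
  rw [← intervalIntegral.integral_Iic_sub_Iic hg.integrable.integrableOn
    hg.integrable.integrableOn]
  simp only [labelOf]; ring

theorem le_labelOf_sub {a b : ℝ} (hab : a ≤ b) : b - a ≤ labelOf g b - labelOf g a := by
  have := intervalIntegral.integral_nonneg_of_forall (μ := volume) hab hg.nonneg
  rw [hg.labelOf_sub]; linarith

theorem abs_sub_le_abs_labelOf_sub (a b : ℝ) : |b - a| ≤ |labelOf g b - labelOf g a| := by
  rcases le_total a b with h | h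
  · exact abs_le_abs_of_nonneg (sub_nonneg.2 h) (hg.le_labelOf_sub h)
  · rw [abs_sub_comm b, abs_sub_comm (labelOf g b)]
    exact abs_le_abs_of_nonneg (sub_nonneg.2 h) (hg.le_labelOf_sub h)

theorem strictMono_labelOf : StrictMono (labelOf g) := fun a b hab => by
  have := hg.le_labelOf_sub hab.le; linarith

theorem continuous_labelOf : Continuous (labelOf g) := by
  have : labelOf g = fun x => labelOf g 0 + ((∫ t in (0 : ℝ)..x, g t) + (x - 0)) := by
    funext x; rw [← hg.labelOf_sub]; ring
  rw [this]
  have h := intervalIntegral.continuous_primitive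
    (intervalIntegrable_of_locallyIntegrable hg.integrable.locallyIntegrable) 0
  fun_prop

theorem le_labelOf (x : ℝ) : x ≤ labelOf g x := by
  have : 0 ≤ ∫ t in Set.Iic x, g t := integral_nonneg hg.nonneg
  simp only [labelOf]; linarith

theorem labelOf_le (x : ℝ) : labelOf g x ≤ (∫ t, g t) + x := by
  have := setIntegral_le_integral hg.integrable (s := Set.Iic x)
    (Eventually.of_forall hg.nonneg)
  simp only [labelOf]; linarith

theorem surjective_labelOf : Function.Surjective (labelOf g) :=
  hg.continuous_labelOf.surjective
    (tendsto_atTop_mono hg.le_labelOf tendsto_id)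
    (tendsto_atBot_mono hg.labelOf_le (tendsto_atBot_add_const_left _ _ tendsto_id))

theorem positionOf_labelOf (x : ℝ) : positionOf g (labelOf g x) = x := by
  simp only [positionOf, hg.strictMono_labelOf.lt_iff_lt]
  exact csSup_Iio

theorem labelOf_positionOf (ξ : ℝ) : labelOf g (positionOf g ξ) = ξ := by
  obtain ⟨x, rfl⟩ := hg.surjective_labelOf ξ
  rw [hg.positionOf_labelOf]

theorem strictMono_positionOf : StrictMono (positionOf g) := fun a b hab => by
  rw [← hg.strictMono_labelOf.lt_iff_lt, hg.labelOf_positionOf, hg.labelOf_positionOf]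
  exact hab

theorem measurable_positionOf : Measurable (positionOf g) :=
  hg.strictMono_positionOf.monotone.measurable

theorem sub_positionOf (ξ : ℝ) : ξ - positionOf g ξ = ∫ t in Set.Iic (positionOf g ξ), g t := by
  nth_rewrite 1 [← hg.labelOf_positionOf ξ]
  simp only [labelOf]; ring

theorem preimage_Ioc (a b : ℝ) :
    positionOf g ⁻¹' Set.Ioc a b = Set.Ioc (labelOf g a) (labelOf g b) := by
  ext ξ
  obtain ⟨z, rfl⟩ := hg.surjective_labelOf ξ
  simp [hg.positionOf_labelOf, hg.strictMono_labelOf.lt_iff_lt, hg.strictMono_labelOf.le_iff_le]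

/-- The preimage of `(a, b]` is the interval between the labels of `a` and `b`, whose length is `∫
(1 + g)` over `(a, b]`; half-open intervals determine the measure. All later changes of variables
come from this identity, with no pointwise differentiation of `positionOf g`. -/
theorem map_positionOf :
    Measure.map (positionOf g) volume = volume.withDensity fun x => ENNReal.ofReal (1 + g x) := by
  refine Measure.ext_of_Ioc' _ _ (fun a b _ => ?_) fun a b hab => ?_
  · rw [Measure.map_apply hg.measurable_positionOf measurableSet_Ioc, hg.preimage_Ioc]
    exact measure_Ioc_lt_top.ne
  have hI : IntegrableOn (fun x => 1 + g x) (Set.Ioc a b) :=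
    (integrableOn_const (by simp)).add hg.integrable.integrableOn
  rw [Measure.map_apply hg.measurable_positionOf measurableSet_Ioc, hg.preimage_Ioc,
    Real.volume_Ioc, withDensity_apply _ measurableSet_Ioc,
    ← ofReal_integral_eq_lintegral_ofReal hI
      (Eventually.of_forall fun x => (hg.one_add_pos x).le),
    hg.labelOf_sub, ← intervalIntegral.integral_of_le hab.le,
    intervalIntegral.integral_add (by simp) hg.integrable.intervalIntegrable]
  simp [add_comm]

theorem lintegral_comp_positionOf {h : ℝ → ℝ≥0∞} (hh : Measurable h) :
    ∫⁻ ξ, h (positionOf g ξ) = ∫⁻ x, ENNReal.ofReal (1 + g x) * h x := by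
  rw [← lintegral_map hh hg.measurable_positionOf, hg.map_positionOf,
    lintegral_withDensity_eq_lintegral_mul _ (hg.measurable.const_add 1).ennreal_ofReal hh]
  rfl

theorem stretchOf_pos (ξ : ℝ) : 0 < stretchOf g ξ := inv_pos.2 (hg.one_add_pos _)

theorem stretchOf_le_one (ξ : ℝ) : stretchOf g ξ ≤ 1 := by
  have := hg.nonneg (positionOf g ξ)
  exact inv_le_one_of_one_le₀ (by linarith)

theorem measurable_stretchOf : Measurable (stretchOf g) :=
  ((hg.measurable.comp hg.measurable_positionOf).const_add 1).inv

theorem lintegral_comp_positionOf_mul_stretchOf {h : ℝ → ℝ≥0∞} (hh : Measurable h) :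
    ∫⁻ ξ, h (positionOf g ξ) * ENNReal.ofReal (stretchOf g ξ) = ∫⁻ x, h x := by
  have := hg.lintegral_comp_positionOf
    (hh.mul (hg.measurable.const_add 1).inv.ennreal_ofReal)
  simp only [Pi.mul_apply, Pi.inv_apply] at this
  refine this.trans (lintegral_congr fun x => ?_)
  rw [mul_comm (h x), ← mul_assoc, ← ENNReal.ofReal_mul (hg.one_add_pos x).le,
    mul_inv_cancel₀ (hg.one_add_pos x).ne', ENNReal.ofReal_one, one_mul]

/-- Since the stretch lies in `(0, 1]`, its `p`-th power is at most itself, and one power cancels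
the density `1 + g`. The constant 1 does not depend on `g`, which makes the approximation errors
below uniform in `n`. -/
theorem eLpNorm_comp_mul_stretchOf_le {h : ℝ → ℝ} (hh : Measurable h) {p : ℝ≥0∞} (hp : 1 ≤ p)
    (hp' : p ≠ (∞ : ℝ≥0∞)) :
    eLpNorm (fun ξ => h (positionOf g ξ) * stretchOf g ξ) p volume ≤ eLpNorm h p volume := by
  have hp0 : p ≠ 0 := (zero_lt_one.trans_le hp).ne'
  have hp1 : 1 ≤ p.toReal := by
    rw [← ENNReal.toReal_one]; exact ENNReal.toReal_mono hp' hp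
  rw [eLpNorm_eq_lintegral_rpow_enorm_toReal hp0 hp',
    eLpNorm_eq_lintegral_rpow_enorm_toReal hp0 hp']
  refine ENNReal.rpow_le_rpow ?_ (by positivity)
  rw [← hg.lintegral_comp_positionOf_mul_stretchOf (h := fun x => ‖h x‖ₑ ^ p.toReal)
    (hh.enorm.pow_const _)]
  refine lintegral_mono fun ξ => ?_
  simp only [enorm_mul]
  rw [ENNReal.mul_rpow_of_nonneg _ _ (by positivity)]
  gcongr
  rw [Real.enorm_eq_ofReal (hg.stretchOf_pos ξ).le]
  calc ENNReal.ofReal (stretchOf g ξ) ^ p.toReal ≤ ENNReal.ofReal (stretchOf g ξ) ^ (1 : ℝ) :=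
        ENNReal.rpow_le_rpow_of_exponent_ge
          (ENNReal.ofReal_le_one.2 (hg.stretchOf_le_one ξ)) hp1
    _ = _ := ENNReal.rpow_one _

/-- The pushforward formula applied to `w / (1 + g)`; it replaces a chain rule for a derivative
known only almost everywhere. -/
theorem comp_positionOf_sub_eq_integral {f w : ℝ → ℝ} (hw : Measurable w)
    (hf : ∀ a b, f b - f a = ∫ x in a..b, w x) (a b : ℝ) :
    f (positionOf g b) - f (positionOf g a) =
      ∫ ξ in a..b, w (positionOf g ξ) * stretchOf g ξ := by
  wlog hab : a ≤ b generalizing a b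
  · rw [intervalIntegral.integral_symm, ← this b a (le_of_not_ge hab)]; ring
  have hpre := hg.preimage_Ioc (positionOf g a) (positionOf g b)
  rw [hg.labelOf_positionOf, hg.labelOf_positionOf] at hpre
  have hm : Measurable fun x => w x * (1 + g x)⁻¹ := hw.mul (hg.measurable.const_add 1).inv
  rw [intervalIntegral.integral_of_le hab, hf,
    intervalIntegral.integral_of_le (hg.strictMono_positionOf.monotone hab), ← hpre]
  have h1 := setIntegral_map (μ := volume) (g := positionOf g)
    (measurableSet_Ioc (a := positionOf g a) (b := positionOf g b))
    hm.aestronglyMeasurable hg.measurable_positionOf.aemeasurable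
  refine Eq.trans ?_ h1
  rw [hg.map_positionOf, setIntegral_withDensity_eq_setIntegral_toReal_smul₀
    (hg.measurable.const_add 1).ennreal_ofReal.aemeasurable (by simp) _ measurableSet_Ioc]
  refine setIntegral_congr_fun measurableSet_Ioc fun x _ => ?_
  have := (hg.one_add_pos x).ne'
  simp only [smul_eq_mul]
  rw [ENNReal.toReal_ofReal (hg.one_add_pos x).le]
  field_simp

theorem hasWeakDeriv_comp_positionOf {f w : ℝ → ℝ} (hf : Continuous f) (hw : Measurable w)
    (hfw : HasWeakDeriv f w) (hb : ∀ x, |w x| ≤ 1 + g x) :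
    HasWeakDeriv (f ∘ positionOf g) (fun ξ => w (positionOf g ξ) * stretchOf g ξ) := by
  refine HasWeakDeriv.of_sub_eq_integral ?_
    (hg.comp_positionOf_sub_eq_integral hw (hfw.sub_eq_integral hf))
  have : MemLp (fun ξ => w (positionOf g ξ) * stretchOf g ξ) (∞ : ℝ≥0∞) volume := by
    refine memLp_top_of_bound
      ((hw.comp hg.measurable_positionOf).mul hg.measurable_stretchOf).aestronglyMeasurable 1
      (Eventually.of_forall fun ξ => ?_)
    rw [Real.norm_eq_abs, abs_mul, abs_of_pos (hg.stretchOf_pos ξ)]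
    exact mul_inv_le_one_of_le₀ (hb _) (hg.one_add_pos _).le
  exact this.locallyIntegrable le_top

end IsEnergyDensity

/-! ### Pairs `(u, u_x)` and their energy -/

/-- `u` belongs to `H¹(ℝ)`, and `w` is a measurable version of its weak derivative. -/
structure IsH1Pair (u w : ℝ → ℝ) : Prop where
  continuous : Continuous u
  measurable : Measurable w
  hasWeakDeriv : HasWeakDeriv u w
  memLp : MemLp u 2 volume
  memLp_deriv : MemLp w 2 volume

theorem MemH1.exists_isH1Pair {u : ℝ → ℝ} (h : MemH1 u) : ∃ w, IsH1Pair u w := by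
  obtain ⟨hc, hu, w, hw, hw2⟩ := h
  have hae := hw2.aestronglyMeasurable.ae_eq_mk
  exact ⟨hw2.aestronglyMeasurable.mk w, hc,
    hw2.aestronglyMeasurable.stronglyMeasurable_mk.measurable, hw.congr hae, hu,
    hw2.ae_eq hae⟩

/-- The energy density `u² + u_x²`. -/
def energyDensity (u w : ℝ → ℝ) (x : ℝ) : ℝ := u x ^ 2 + w x ^ 2

theorem abs_le_one_add_energyDensity (u w : ℝ → ℝ) (x : ℝ) : |w x| ≤ 1 + energyDensity u w x := by
  rw [energyDensity]
  nlinarith [sq_nonneg (u x), sq_abs (w x), sq_nonneg (|w x| - 1), abs_nonneg (w x)]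

theorem eLpNorm_two_sq (f : ℝ → ℝ) :
    eLpNorm f 2 volume ^ 2 = ∫⁻ x, ENNReal.ofReal (f x ^ 2) := by
  rw [eLpNorm_eq_lintegral_rpow_enorm_toReal (by simp) (by simp)]
  simp only [ENNReal.toReal_ofNat, ENNReal.rpow_ofNat]
  rw [← ENNReal.rpow_natCast, ← ENNReal.rpow_mul]
  simp only [Nat.cast_ofNat, one_div, inv_mul_cancel₀ (two_ne_zero' ℝ), ENNReal.rpow_one]
  refine lintegral_congr fun x => ?_
  rw [← ofReal_norm, ← ENNReal.ofReal_pow (norm_nonneg _), Real.norm_eq_abs, sq_abs]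

/-- Cauchy–Schwarz, obtained by expanding `∫ (L w - I)² ≥ 0` and dividing by `L`. -/
theorem sq_intervalIntegral_le {w : ℝ → ℝ} {a b : ℝ} (hab : a ≤ b)
    (hw : IntervalIntegrable w volume a b)
    (hw2 : IntervalIntegrable (fun x => w x ^ 2) volume a b) :
    (∫ x in a..b, w x) ^ 2 ≤ (b - a) * ∫ x in a..b, w x ^ 2 := by
  rcases hab.eq_or_lt with rfl | hlt
  · simp
  set I := ∫ x in a..b, w x
  set L := b - a with hL
  have hLpos : 0 < L := sub_pos.2 hlt
  have h0 : 0 ≤ ∫ x in a..b, (L * w x - I) ^ 2 :=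
    intervalIntegral.integral_nonneg hab fun x _ => sq_nonneg _
  have h1 : ∫ x in a..b, (L * w x - I) ^ 2 =
      L ^ 2 * (∫ x in a..b, w x ^ 2) - 2 * L * I * I + L * I ^ 2 := by
    have : ∀ x, (L * w x - I) ^ 2 = L ^ 2 * w x ^ 2 - 2 * L * I * w x + I ^ 2 := fun x => by ring
    simp only [this]
    rw [intervalIntegral.integral_add ((hw2.const_mul _).sub (hw.const_mul _)) (by simp),
      intervalIntegral.integral_sub (hw2.const_mul _) (hw.const_mul _),
      intervalIntegral.integral_const_mul, intervalIntegral.integral_const_mul,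
      intervalIntegral.integral_const, smul_eq_mul]
  have h2 : 0 ≤ L * (L * (∫ x in a..b, w x ^ 2) - I ^ 2) := by
    rw [h1] at h0; linarith
  linarith [nonneg_of_mul_nonneg_right h2 hLpos]

namespace IsH1Pair

variable {u w : ℝ → ℝ} (h : IsH1Pair u w)

include h

theorem isEnergyDensity : IsEnergyDensity (energyDensity u w) where
  measurable := (h.continuous.measurable.pow_const 2).add (h.measurable.pow_const 2)
  nonneg _ := add_nonneg (sq_nonneg _) (sq_nonneg _)
  integrable := h.memLp.integrable_sq.add h.memLp_deriv.integrable_sq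

theorem energyMeasure_eq :
    energyMeasure u = volume.withDensity fun x => ENNReal.ofReal (energyDensity u w x) := by
  refine withDensity_congr_ae ?_
  filter_upwards [h.hasWeakDeriv.weakDeriv_ae_eq] with x hx
  rw [hx, energyDensity]

theorem lagMap_eq : lagMap (u, energyMeasure u) =
    ⟨positionOf (energyDensity u w), u ∘ positionOf (energyDensity u w),
      fun ξ => ξ - positionOf (energyDensity u w) ξ⟩ := by
  have hg := h.isEnergyDensity
  have key : ∀ x, (energyMeasure u).real (Set.Iio x) + x = labelOf (energyDensity u w) x := by
    intro x
    rw [labelOf, measureReal_def, h.energyMeasure_eq, withDensity_apply _ measurableSet_Iio,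
      ← ofReal_integral_eq_lintegral_ofReal hg.integrable.integrableOn
        (Eventually.of_forall hg.nonneg),
      ENNReal.toReal_ofReal (integral_nonneg hg.nonneg), integral_Iic_eq_integral_Iio]
  simp only [lagMap, key]
  rfl

theorem mem_setD : (u, energyMeasure u) ∈ setD := by
  have hg := h.isEnergyDensity
  refine ⟨⟨h.continuous, h.memLp, w, h.hasWeakDeriv, h.memLp_deriv⟩, ?_, ?_⟩
  · simp only [h.energyMeasure_eq]
    exact isFiniteMeasure_withDensity_ofReal hg.integrable.2
  · simp only [h.energyMeasure_eq]
    exact withDensity_congr_ae (Measure.rnDeriv_withDensity _ hg.measurable.ennreal_ofReal)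

/-- Sobolev embedding: bound `u x` by `u z` plus the oscillation, then average over `z` in `[x, x +
1]`. -/
theorem sq_le (x : ℝ) : u x ^ 2 ≤ 2 * ((∫ z, u z ^ 2) + ∫ z, w z ^ 2) := by
  have hu2 := h.memLp.integrable_sq
  have hw2 := h.memLp_deriv.integrable_sq
  have hwI := intervalIntegrable_of_locallyIntegrable h.hasWeakDeriv.2.1
  have hpt : ∀ z ∈ Set.Icc x (x + 1), u x ^ 2 ≤ 2 * u z ^ 2 + 2 * ∫ z, w z ^ 2 := by
    intro z hz
    have h1 := h.hasWeakDeriv.sub_eq_integral h.continuous x z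
    have h2 := sq_intervalIntegral_le hz.1 (hwI x z) hw2.intervalIntegrable
    have h3 : ∫ t in x..z, w t ^ 2 ≤ ∫ t, w t ^ 2 := by
      rw [intervalIntegral.integral_of_le hz.1]
      exact setIntegral_le_integral hw2 (Eventually.of_forall fun t => sq_nonneg _)
    have h4 : 0 ≤ ∫ t, w t ^ 2 := integral_nonneg fun t => sq_nonneg _
    have h5 : (z - x) * (∫ t in x..z, w t ^ 2) ≤ 1 * ∫ t, w t ^ 2 :=
      mul_le_mul (by linarith [hz.2]) h3
        (intervalIntegral.integral_nonneg hz.1 fun t _ => sq_nonneg _) zero_le_one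
    rw [← h1] at h2
    nlinarith [sq_nonneg (2 * u z - u x)]
  have hmono := intervalIntegral.integral_mono_on (μ := volume) (by linarith : x ≤ x + 1)
    (by simp) ((hu2.intervalIntegrable.const_mul 2).add (by simp)) hpt
  rw [intervalIntegral.integral_const, intervalIntegral.integral_add
    (hu2.intervalIntegrable.const_mul 2) (by simp), intervalIntegral.integral_const,
    intervalIntegral.integral_const_mul,
    intervalIntegral.integral_of_le (by linarith : x ≤ x + 1)] at hmono
  have h6 : ∫ t in Set.Ioc x (x + 1), u t ^ 2 ≤ ∫ t, u t ^ 2 :=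
    setIntegral_le_integral hu2 (Eventually.of_forall fun t => sq_nonneg _)
  simp only [add_sub_cancel_left, one_smul] at hmono
  linarith

theorem hasWeakDeriv_comp : HasWeakDeriv (u ∘ positionOf (energyDensity u w))
    (fun ξ => w (positionOf (energyDensity u w) ξ) * stretchOf (energyDensity u w) ξ) :=
  h.isEnergyDensity.hasWeakDeriv_comp_positionOf h.continuous h.measurable h.hasWeakDeriv
    (abs_le_one_add_energyDensity u w)

end IsH1Pair

/-! ### Regularity of `ζ` and `H` -/

namespace IsEnergyDensity

variable {g : ℝ → ℝ} (hg : IsEnergyDensity g)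

include hg

theorem hasWeakDeriv_positionOf : HasWeakDeriv (positionOf g) (stretchOf g) := by
  have h := hg.hasWeakDeriv_comp_positionOf (f := id) (w := fun _ => 1) continuous_id
    measurable_const
    (HasWeakDeriv.of_sub_eq_integral (locallyIntegrable_const _) fun a b => by simp)
    (fun x => by have := hg.nonneg x; simp [this])
  simpa using h

theorem hasWeakDeriv_zeta :
    HasWeakDeriv (fun ξ => positionOf g ξ - ξ) (fun ξ => stretchOf g ξ - 1) :=
  hg.hasWeakDeriv_positionOf.sub
    (HasWeakDeriv.of_sub_eq_integral (locallyIntegrable_const _) fun a b => by simp)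

theorem hasWeakDeriv_sub_positionOf :
    HasWeakDeriv (fun ξ => ξ - positionOf g ξ) (fun ξ => 1 - stretchOf g ξ) :=
  HasWeakDeriv.sub
    (HasWeakDeriv.of_sub_eq_integral (locallyIntegrable_const _) fun a b => by simp)
    hg.hasWeakDeriv_positionOf

theorem continuous_positionOf : Continuous (positionOf g) :=
  continuous_of_sub_eq_integral hg.hasWeakDeriv_positionOf.2.1 fun a b => by
    simpa using hg.comp_positionOf_sub_eq_integral (f := id) (w := fun _ => 1)
      measurable_const (fun a b => by simp) a b

theorem abs_sub_positionOf_le (ξ : ℝ) : |ξ - positionOf g ξ| ≤ ∫ t, g t := by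
  rw [hg.sub_positionOf, abs_of_nonneg (integral_nonneg hg.nonneg)]
  exact setIntegral_le_integral hg.integrable (Eventually.of_forall hg.nonneg)

/-- With `q` the stretch, `(1 - q)² ≤ 1 - q = (g ∘ y) q`, and the last function has integral `∫ g`.
-/
theorem memLp_one_sub_stretchOf : MemLp (fun ξ => 1 - stretchOf g ξ) 2 volume := by
  have hm : Measurable fun ξ => 1 - stretchOf g ξ := hg.measurable_stretchOf.const_sub 1
  refine (memLp_two_iff_integrable_sq hm.aestronglyMeasurable).2 ?_
  refine ⟨(hm.pow_const 2).aestronglyMeasurable, ?_⟩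
  have h1 := hg.lintegral_comp_positionOf_mul_stretchOf (hg.measurable.ennreal_ofReal)
  refine lt_of_le_of_lt (lintegral_mono fun ξ => ?_) (h1.trans_lt hg.integrable.lintegral_lt_top)
  rw [Real.enorm_eq_ofReal (sq_nonneg _), ← ENNReal.ofReal_mul (hg.nonneg _)]
  refine ENNReal.ofReal_le_ofReal ?_
  have hs := hg.stretchOf_pos ξ
  have hs1 := hg.stretchOf_le_one ξ
  have : g (positionOf g ξ) * stretchOf g ξ = 1 - stretchOf g ξ := by
    have := (hg.one_add_pos (positionOf g ξ)).ne'
    rw [stretchOf]; field_simp; ring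
  rw [this]
  nlinarith

theorem tendsto_sub_positionOf_atBot :
    Tendsto (fun ξ => ξ - positionOf g ξ) atBot (𝓝 0) := by
  simp only [hg.sub_positionOf]
  have hpos : Tendsto (positionOf g) atBot atBot :=
    tendsto_atBot_mono (fun ξ => by
      have := hg.le_labelOf (positionOf g ξ); rwa [hg.labelOf_positionOf] at this) tendsto_id
  refine Tendsto.comp (g := fun x => ∫ t in Set.Iic x, g t) ?_ hpos
  have hlim := intervalIntegral_tendsto_integral_Iic (0 : ℝ) hg.integrable.integrableOn tendsto_id
  have : (fun x => ∫ t in Set.Iic x, g t) =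
      fun x => (∫ t in Set.Iic (0 : ℝ), g t) - ∫ t in (id x)..0, g t := by
    funext x
    rw [← intervalIntegral.integral_Iic_sub_Iic hg.integrable.integrableOn
      hg.integrable.integrableOn]
    simp
  rw [this]
  simpa using hlim.const_sub (∫ t in Set.Iic (0 : ℝ), g t)

theorem memV_sub_positionOf : MemV fun ξ => ξ - positionOf g ξ :=
  ⟨continuous_id.sub hg.continuous_positionOf,
    memLp_top_of_bound (continuous_id.sub hg.continuous_positionOf).aestronglyMeasurable _
      (Eventually.of_forall hg.abs_sub_positionOf_le),
    _, hg.hasWeakDeriv_sub_positionOf, hg.memLp_one_sub_stretchOf⟩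

theorem memV_zeta : MemV fun ξ => positionOf g ξ - ξ := by
  refine ⟨hg.continuous_positionOf.sub continuous_id,
    memLp_top_of_bound (hg.continuous_positionOf.sub continuous_id).aestronglyMeasurable
      (∫ t, g t) (Eventually.of_forall fun ξ => ?_), _, hg.hasWeakDeriv_zeta, ?_⟩
  · rw [Real.norm_eq_abs, abs_sub_comm]; exact hg.abs_sub_positionOf_le ξ
  · simpa [Pi.neg_def] using hg.memLp_one_sub_stretchOf.neg

theorem memW1Inf_sub_positionOf : MemW1Inf fun ξ => ξ - positionOf g ξ := by
  refine ⟨hg.memV_sub_positionOf.1, hg.memV_sub_positionOf.2.1, _, hg.hasWeakDeriv_sub_positionOf,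
    memLp_top_of_bound (hg.measurable_stretchOf.const_sub 1).aestronglyMeasurable 1
      (Eventually.of_forall fun ξ => ?_)⟩
  have := hg.stretchOf_pos ξ
  have := hg.stretchOf_le_one ξ
  rw [Real.norm_eq_abs, abs_le]; constructor <;> linarith

theorem memW1Inf_zeta : MemW1Inf fun ξ => positionOf g ξ - ξ := by
  refine ⟨hg.memV_zeta.1, hg.memV_zeta.2.1, _, hg.hasWeakDeriv_zeta,
    memLp_top_of_bound (hg.measurable_stretchOf.sub_const 1).aestronglyMeasurable 1
      (Eventually.of_forall fun ξ => ?_)⟩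
  have := hg.stretchOf_pos ξ
  have := hg.stretchOf_le_one ξ
  rw [Real.norm_eq_abs, abs_le]; constructor <;> linarith

end IsEnergyDensity

/-! ### Regularity of `U` -/

namespace IsH1Pair

variable {u w : ℝ → ℝ} (h : IsH1Pair u w)

include h

/-- Without the weight, composition turns `dx` into `(1 + g) dx`; the extra term `∫ f² g` is bounded
by the supremum bound on `f²` times the total energy. -/
theorem eLpNorm_comp_positionOf_sq_le {f : ℝ → ℝ} (hf : Measurable f) {C : ℝ}
    (hC : ∀ x, f x ^ 2 ≤ C) :
    eLpNorm (f ∘ positionOf (energyDensity u w)) 2 volume ^ 2 ≤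
      eLpNorm f 2 volume ^ 2 +
        ENNReal.ofReal C * ∫⁻ x, ENNReal.ofReal (energyDensity u w x) := by
  have hg := h.isEnergyDensity
  rw [eLpNorm_two_sq, eLpNorm_two_sq, ← lintegral_const_mul _ hg.measurable.ennreal_ofReal,
    ← lintegral_add_left (hf.pow_const 2).ennreal_ofReal]
  simp only [Function.comp_apply]
  rw [hg.lintegral_comp_positionOf (h := fun x => ENNReal.ofReal (f x ^ 2))
    (hf.pow_const 2).ennreal_ofReal]
  refine lintegral_mono fun x => ?_
  rw [ENNReal.ofReal_add zero_le_one (hg.nonneg x), add_mul, ENNReal.ofReal_one, one_mul, mul_comm]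
  gcongr
  exact hC x

theorem memLp_comp_positionOf : MemLp (u ∘ positionOf (energyDensity u w)) 2 volume := by
  have hg := h.isEnergyDensity
  refine ⟨(h.continuous.comp hg.continuous_positionOf).aestronglyMeasurable, ?_⟩
  have := h.eLpNorm_comp_positionOf_sq_le h.continuous.measurable h.sq_le
  refine (or_iff_left two_ne_zero).1 (ENNReal.pow_lt_top_iff.1 (this.trans_lt ?_))
  exact ENNReal.add_lt_top.2 ⟨ENNReal.pow_lt_top h.memLp.2,
    ENNReal.mul_lt_top ENNReal.ofReal_lt_top hg.integrable.lintegral_lt_top⟩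

theorem memLp_deriv_comp :
    MemLp (fun ξ => w (positionOf (energyDensity u w) ξ) * stretchOf (energyDensity u w) ξ) 2
      volume :=
  have hg := h.isEnergyDensity
  ⟨((h.measurable.comp hg.measurable_positionOf).mul hg.measurable_stretchOf).aestronglyMeasurable,
    (hg.eLpNorm_comp_mul_stretchOf_le h.measurable (by norm_num) (by simp)).trans_lt
      h.memLp_deriv.2⟩

theorem memH1_comp_positionOf : MemH1 (u ∘ positionOf (energyDensity u w)) :=
  ⟨h.continuous.comp h.isEnergyDensity.continuous_positionOf, h.memLp_comp_positionOf, _,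
    h.hasWeakDeriv_comp, h.memLp_deriv_comp⟩

theorem memW1Inf_comp_positionOf : MemW1Inf (u ∘ positionOf (energyDensity u w)) := by
  have hg := h.isEnergyDensity
  refine ⟨h.memH1_comp_positionOf.1, memLp_top_of_bound
    h.memH1_comp_positionOf.1.aestronglyMeasurable _
      (Eventually.of_forall fun ξ => Real.abs_le_sqrt (h.sq_le _)), _, h.hasWeakDeriv_comp,
    memLp_top_of_bound h.memLp_deriv_comp.1 1 (Eventually.of_forall fun ξ => ?_)⟩
  rw [Real.norm_eq_abs, abs_mul, abs_of_pos (hg.stretchOf_pos ξ)]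
  exact mul_inv_le_one_of_le₀ (abs_le_one_add_energyDensity u w _) (hg.one_add_pos _).le

end IsH1Pair

/-! ### The identity relabeling and membership in `ℱ₀` -/

theorem hasWeakDeriv_const (c : ℝ) : HasWeakDeriv (fun _ => c) (fun _ => 0) :=
  HasWeakDeriv.of_sub_eq_integral (locallyIntegrable_const _) fun a b => by simp

theorem memW1Inf_zero : MemW1Inf fun _ => 0 :=
  ⟨continuous_const, MemLp.zero', _, hasWeakDeriv_const 0, MemLp.zero'⟩

theorem w1InfNorm_zero : w1InfNorm (fun _ => 0) = 0 := by
  rw [w1InfNorm, if_pos memW1Inf_zero, eLpNorm_congr_ae (hasWeakDeriv_const 0).weakDeriv_ae_eq,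
    eLpNorm_zero', add_zero]

theorem refl_mem_relabelings : Homeomorph.refl ℝ ∈ relabelings := by
  refine ⟨by simpa using memW1Inf_zero, by simpa using memW1Inf_zero, ?_⟩
  have hid : HasWeakDeriv (Homeomorph.refl ℝ) fun _ => 1 :=
    HasWeakDeriv.of_sub_eq_integral (locallyIntegrable_const _) fun a b => by simp
  refine (MemLp.zero' (p := 2) (μ := (volume : Measure ℝ)) (ε := ℝ)).ae_eq ?_
  filter_upwards [hid.weakDeriv_ae_eq] with x hx
  rw [hx, sub_self]

theorem refl_mem_relabelingsBdd : Homeomorph.refl ℝ ∈ relabelingsBdd 0 :=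
  ⟨refl_mem_relabelings, by simp [w1InfNorm_zero]⟩

theorem IsH1Pair.lagMap_mem_setF {u w : ℝ → ℝ} (h : IsH1Pair u w) :
    lagMap (u, energyMeasure u) ∈ setF 0 := by
  have hg := h.isEnergyDensity
  rw [h.lagMap_eq]
  refine ⟨⟨⟨hg.memV_zeta, h.memH1_comp_positionOf, hg.memV_sub_positionOf⟩, hg.memW1Inf_zeta,
    h.memW1Inf_comp_positionOf, hg.memW1Inf_sub_positionOf, ?_, hg.tendsto_sub_positionOf_atBot,
    ?_⟩, Homeomorph.refl ℝ, refl_mem_relabelingsBdd, fun ξ => by simp⟩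
  · filter_upwards [hg.hasWeakDeriv_positionOf.weakDeriv_ae_eq,
      hg.hasWeakDeriv_sub_positionOf.weakDeriv_ae_eq] with ξ h1 h2
    rw [h1, h2]
    have := hg.stretchOf_pos ξ
    have := hg.stretchOf_le_one ξ
    exact ⟨by linarith, by linarith, by linarith⟩
  · filter_upwards [hg.hasWeakDeriv_positionOf.weakDeriv_ae_eq,
      hg.hasWeakDeriv_sub_positionOf.weakDeriv_ae_eq, h.hasWeakDeriv_comp.weakDeriv_ae_eq]
      with ξ h1 h2 h3
    rw [h1, h2, h3]
    -- With `q = 1 / (1 + g)` the goal is `q (1 - q) = q² (u² + w²)`, that is, `1 - q = q g`.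
    have hne := (hg.one_add_pos (positionOf (energyDensity u w) ξ)).ne'
    simp only [stretchOf, Function.comp_apply]
    simp only [energyDensity] at hne ⊢
    field_simp
    ring

/-! ### Convergence in Lagrangian coordinates -/

theorem tendsto_zero_of_le_add {a : ℕ → ℝ≥0∞}
    (h : ∀ η : ℝ≥0∞, η ≠ 0 → ∃ c : ℕ → ℝ≥0∞, Tendsto c atTop (𝓝 0) ∧ ∀ n, a n ≤ η + c n) :
    Tendsto a atTop (𝓝 0) := by
  refine ENNReal.tendsto_nhds_zero.2 fun ε hε => ?_
  have hε2 : 0 < ε / 2 := ENNReal.half_pos hε.ne'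
  obtain ⟨c, hc, hac⟩ := h (ε / 2) hε2.ne'
  filter_upwards [ENNReal.tendsto_nhds_zero.1 hc (ε / 2) hε2] with n hn
  calc a n ≤ ε / 2 + c n := hac n
    _ ≤ ε / 2 + ε / 2 := by gcongr
    _ = ε := ENNReal.add_halves ε

theorem tendsto_zero_of_sq {a : ℕ → ℝ≥0∞} (h : Tendsto (fun n => a n ^ 2) atTop (𝓝 0)) :
    Tendsto a atTop (𝓝 0) := by
  have := (ENNReal.continuous_rpow_const (y := (1 / 2 : ℝ))).tendsto 0 |>.comp h
  rw [ENNReal.zero_rpow_of_pos (by norm_num)] at this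
  refine this.congr fun n => ?_
  simp only [Function.comp_apply]
  rw [← ENNReal.rpow_natCast, ← ENNReal.rpow_mul]
  norm_num

theorem tendsto_sq_zero {a : ℕ → ℝ≥0∞} (h : Tendsto a atTop (𝓝 0)) :
    Tendsto (fun n => a n ^ 2) atTop (𝓝 0) := by
  simpa using ENNReal.Tendsto.pow (n := 2) h

theorem tendsto_const_mul_zero {a : ℕ → ℝ≥0∞} (h : Tendsto a atTop (𝓝 0)) {c : ℝ≥0∞}
    (hc : c ≠ ⊤) : Tendsto (fun n => c * a n) atTop (𝓝 0) := by
  simpa using ENNReal.Tendsto.const_mul h (Or.inr hc)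

theorem tendsto_add_zero {a b : ℕ → ℝ≥0∞} (ha : Tendsto a atTop (𝓝 0))
    (hb : Tendsto b atTop (𝓝 0)) : Tendsto (fun n => a n + b n) atTop (𝓝 0) := by
  simpa using ha.add hb

theorem eLpNorm_le_add_add {f A B C : ℝ → ℝ} {p : ℝ≥0∞} (hp : 1 ≤ p) (hA : Measurable A)
    (hB : Measurable B) (hC : Measurable C) (h : ∀ x, |f x| ≤ |A x| + |B x| + |C x|) :
    eLpNorm f p volume ≤ eLpNorm A p volume + eLpNorm B p volume + eLpNorm C p volume := by
  have h1 : eLpNorm f p volume ≤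
      eLpNorm ((fun x => ‖A x‖) + (fun x => ‖B x‖) + fun x => ‖C x‖) p volume :=
    eLpNorm_mono_real h
  refine h1.trans ((eLpNorm_add_le ?_ ?_ hp).trans ?_)
  · exact (hA.norm.add hB.norm).aestronglyMeasurable
  · exact hC.norm.aestronglyMeasurable
  rw [eLpNorm_norm]
  gcongr
  refine (eLpNorm_add_le hA.norm.aestronglyMeasurable hB.norm.aestronglyMeasurable hp).trans ?_
  rw [eLpNorm_norm, eLpNorm_norm]

theorem eLpNorm_sub_comm' (f g : ℝ → ℝ) (p : ℝ≥0∞) :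
    eLpNorm (fun x => f x - g x) p volume = eLpNorm (fun x => g x - f x) p volume :=
  eLpNorm_sub_comm f g p volume

theorem eLpNorm_sub_le_add {f g k : ℝ → ℝ} {p : ℝ≥0∞} (hp : 1 ≤ p) (hf : Measurable f)
    (hg : Measurable g) (hk : Measurable k) :
    eLpNorm (fun x => f x - k x) p volume ≤
      eLpNorm (fun x => f x - g x) p volume + eLpNorm (fun x => g x - k x) p volume := by
  have := eLpNorm_add_le (μ := volume) (hf.sub hg).aestronglyMeasurable
    (hg.sub hk).aestronglyMeasurable hp
  refine le_trans (le_of_eq ?_) this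
  congr 1
  funext x
  simp

theorem eLpNorm_two_sq_le_eLpNorm_one {f : ℝ → ℝ} (hf : ∀ x, |f x| ≤ 1) :
    eLpNorm f 2 volume ^ 2 ≤ eLpNorm f 1 volume := by
  rw [eLpNorm_two_sq, eLpNorm_one_eq_lintegral_enorm]
  refine lintegral_mono fun x => ?_
  rw [← ofReal_norm, Real.norm_eq_abs]
  refine ENNReal.ofReal_le_ofReal ?_
  rw [← sq_abs]
  nlinarith [hf x, abs_nonneg (f x)]

/-- Hölder for `(f - g)(f + g)`, with `f + g = (f - g) + 2g` so that the bound involves only the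
difference and the fixed `g`. -/
theorem eLpNorm_one_sq_sub_sq_le {f g : ℝ → ℝ} (hf : Measurable f) (hg : Measurable g) :
    eLpNorm (fun x => f x ^ 2 - g x ^ 2) 1 volume ≤
      eLpNorm (fun x => f x - g x) 2 volume *
        (eLpNorm (fun x => f x - g x) 2 volume +
          (eLpNorm g 2 volume + eLpNorm g 2 volume)) := by
  have h1 := eLpNorm_smul_le_mul_eLpNorm (p := 2) (q := 2) (r := 1) (μ := (volume : Measure ℝ))
    (hf.add hg).aestronglyMeasurable (hf.sub hg).aestronglyMeasurable
  have h2 : eLpNorm (f + g) 2 volume ≤ eLpNorm (fun x => f x - g x) 2 volume +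
      (eLpNorm g 2 volume + eLpNorm g 2 volume) := by
    have h3 : f + g = (fun x => f x - g x) + (g + g) := by
      funext x; simp only [Pi.add_apply]; ring
    have hm : AEStronglyMeasurable (fun x => f x - g x) volume := (hf.sub hg).aestronglyMeasurable
    have hm' : AEStronglyMeasurable g volume := hg.aestronglyMeasurable
    rw [h3]
    exact (eLpNorm_add_le hm (hm'.add hm') one_le_two).trans
      (add_le_add le_rfl (eLpNorm_add_le hm' hm' one_le_two))
  have h4 : (fun x => f x ^ 2 - g x ^ 2) = (f - g) • (f + g) := by
    funext x
    simp only [Pi.smul_apply', Pi.sub_apply, Pi.add_apply, smul_eq_mul]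
    ring
  rw [h4]
  exact h1.trans (mul_le_mul' le_rfl h2)

/-- Composition of a continuous compactly supported function with uniformly convergent maps. -/
theorem tendsto_eLpNorm_comp_sub_comp {Y : ℕ → ℝ → ℝ} {Y₀ : ℝ → ℝ} {δ : ℕ → ℝ} {M : ℝ}
    (hδ : Tendsto δ atTop (𝓝 0)) (hY : ∀ n ξ, |Y n ξ - Y₀ ξ| ≤ δ n)
    (hY₀ : ∀ ξ, |ξ - Y₀ ξ| ≤ M) {k : ℝ → ℝ} (hk : Continuous k) (hkc : HasCompactSupport k)
    (p : ℝ≥0∞) :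
    Tendsto (fun n => eLpNorm (fun ξ => k (Y n ξ) - k (Y₀ ξ)) p volume) atTop (𝓝 0) := by
  obtain ⟨R, hR⟩ := hkc.isCompact.isBounded.subset_closedBall 0
  have hk0 : ∀ x, R < |x| → k x = 0 := fun x hx => image_eq_zero_of_notMem_tsupport fun hx' => by
    have := hR hx'
    rw [Metric.mem_closedBall, dist_zero_right, Real.norm_eq_abs] at this
    linarith
  -- Outside `S` one has `|Y₀ ξ| > R + 1`, hence `|Y n ξ| > R` once `δ n < 1`, so both values of `k`
  -- vanish.
  set S : Set ℝ := Set.Icc (-(R + 1 + M)) (R + 1 + M) with hS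
  set V : ℝ≥0∞ := (volume.restrict S) Set.univ ^ p.toReal⁻¹ with hV
  have hVfin : V ≠ ⊤ :=
    ENNReal.rpow_ne_top_of_nonneg (by positivity) (by simp [hS])
  have huc := hkc.uniformContinuous_of_continuous hk
  refine ENNReal.tendsto_nhds_zero.2 fun ε hε => ?_
  obtain ⟨η, hη, hηV⟩ := ENNReal.exists_nnreal_pos_mul_lt hVfin hε.ne'
  obtain ⟨r, hr, hkr⟩ := Metric.uniformContinuous_iff.1 huc η (by exact_mod_cast hη)
  filter_upwards [hδ.eventually (gt_mem_nhds hr), hδ.eventually (gt_mem_nhds one_pos)] with n hn hn1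
  have hind : (fun ξ => k (Y n ξ) - k (Y₀ ξ)) =
      S.indicator fun ξ => k (Y n ξ) - k (Y₀ ξ) := by
    refine (Set.indicator_eq_self.2 fun ξ hξ => ?_).symm
    by_contra hS'
    have hbig : R + 1 + M < |ξ| := by
      rw [hS, Set.mem_Icc, ← abs_le] at hS'
      exact not_le.1 hS'
    have h1 := hY n ξ
    have h2 := hY₀ ξ
    have h3 := abs_sub_abs_le_abs_sub ξ (Y₀ ξ)
    have h4 := abs_sub_abs_le_abs_sub (Y₀ ξ) (Y n ξ)
    rw [abs_sub_comm (Y₀ ξ)] at h4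
    refine hξ ?_
    simp only
    rw [hk0 (Y n ξ) (by linarith), hk0 (Y₀ ξ) (by linarith), sub_zero]
  rw [hind, eLpNorm_indicator_eq_eLpNorm_restrict measurableSet_Icc]
  refine (eLpNorm_le_of_ae_bound (C := η) (Eventually.of_forall fun ξ => ?_)).trans ?_
  · have := hkr (a := Y n ξ) (b := Y₀ ξ) (by rw [Real.dist_eq]; exact (hY n ξ).trans_lt hn)
    rw [Real.dist_eq] at this
    exact this.le
  · rw [ENNReal.ofReal_coe_nnreal, mul_comm]
    exact hηV.le

/-- Translating an `H¹` function by at most `δ` changes it by `O(δ)` in `L²`. -/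
theorem eLpNorm_comp_sub_self_sq_le {f w : ℝ → ℝ} (hf : Continuous f) (hw : Measurable w)
    (hfw : HasWeakDeriv f w) (hw2 : MemLp w 2 volume) {s : ℝ → ℝ} {δ : ℝ}
    (hs : ∀ ξ, |s ξ - ξ| ≤ δ) :
    eLpNorm (fun ξ => f (s ξ) - f ξ) 2 volume ^ 2 ≤
      ENNReal.ofReal (2 * δ ^ 2) * eLpNorm w 2 volume ^ 2 := by
  have hδ : 0 ≤ δ := (abs_nonneg _).trans (hs 0)
  have hsq := hw2.integrable_sq
  have hwI := intervalIntegrable_of_locallyIntegrable hfw.2.1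
  -- Cauchy–Schwarz on the segment, then enlargement to the window `[ξ - δ, ξ + δ]`. The window no
  -- longer involves `s`, so `s` need not be measurable.
  have hle : ∀ a b ξ, a ≤ b → b - a ≤ δ → ξ - δ ≤ a → b ≤ ξ + δ →
      (f b - f a) ^ 2 ≤ δ * ∫ t in (-δ)..δ, w (ξ + t) ^ 2 := by
    intro a b ξ hab hba ha hb
    rw [hfw.sub_eq_integral hf, intervalIntegral.integral_comp_add_left (fun t => w t ^ 2) ξ]
    refine (sq_intervalIntegral_le hab (hwI a b) hsq.intervalIntegrable).trans ?_
    refine mul_le_mul hba ?_ (intervalIntegral.integral_nonneg hab fun t _ => sq_nonneg _) hδ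
    exact intervalIntegral.integral_mono_interval (by linarith) hab (by linarith)
      (Eventually.of_forall fun t => sq_nonneg _) hsq.intervalIntegrable
  have hpt : ∀ ξ, ENNReal.ofReal ((f (s ξ) - f ξ) ^ 2) ≤
      ENNReal.ofReal δ * ∫⁻ t in Set.Ioc (-δ) δ, ENNReal.ofReal (w (ξ + t) ^ 2) := by
    intro ξ
    have h1 : (f (s ξ) - f ξ) ^ 2 ≤ δ * ∫ t in (-δ)..δ, w (ξ + t) ^ 2 := by
      have := abs_le.1 (hs ξ)
      rcases le_total ξ (s ξ) with h | h
      · exact hle _ _ ξ h (by linarith) (by linarith) (by linarith)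
      · rw [sub_sq_comm]
        exact hle _ _ ξ h (by linarith) (by linarith) (by linarith)
    refine (ENNReal.ofReal_le_ofReal h1).trans ?_
    rw [ENNReal.ofReal_mul hδ, intervalIntegral.integral_of_le (by linarith),
      ofReal_integral_eq_lintegral_ofReal (hsq.comp_add_left ξ).integrableOn
        (Eventually.of_forall fun t => sq_nonneg _)]
  have hmeas : Measurable fun q : ℝ × ℝ => ENNReal.ofReal (w (q.1 + q.2) ^ 2) :=
    ((hw.comp (measurable_fst.add measurable_snd)).pow_const 2).ennreal_ofReal
  rw [eLpNorm_two_sq, eLpNorm_two_sq]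
  refine (lintegral_mono hpt).trans ?_
  -- By Tonelli and translation invariance each shift `t` contributes `‖w‖²`; the window length `2δ`
  -- times the factor `δ` gives `2δ²`.
  rw [lintegral_const_mul _ (hmeas.lintegral_prod_right' (ν := volume.restrict (Set.Ioc (-δ) δ))),
    lintegral_lintegral_swap hmeas.aemeasurable]
  simp only [lintegral_add_right_eq_self fun x => ENNReal.ofReal (w x ^ 2)]
  rw [lintegral_const, Measure.restrict_apply_univ, Real.volume_Ioc, mul_left_comm,
    ← ENNReal.ofReal_mul hδ, mul_comm]
  refine le_of_eq ?_
  congr 2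
  ring

/-! ### Stability of positions and stretches under `L¹` perturbation of the density -/

namespace IsEnergyDensity

variable {g g' : ℝ → ℝ} (hg : IsEnergyDensity g) (hg' : IsEnergyDensity g')

include hg hg'

/-- Since `ξ` is the `g'`-label of its position, the difference of labels is an integral of `g - g'`
over a half-line. -/
theorem abs_labelOf_positionOf_sub_le (ξ : ℝ) : |labelOf g (positionOf g' ξ) - ξ| ≤
    (eLpNorm (fun x => g' x - g x) 1 volume).toReal := by
  nth_rewrite 2 [← hg'.labelOf_positionOf ξ]
  have hm : AEStronglyMeasurable (fun x => g' x - g x) volume :=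
    (hg'.measurable.sub hg.measurable).aestronglyMeasurable
  rw [eLpNorm_one_eq_lintegral_enorm, ← integral_norm_eq_lintegral_enorm hm]
  set x := positionOf g' ξ
  have : labelOf g x - labelOf g' x = -∫ t in Set.Iic x, (g' t - g t) := by
    rw [integral_sub hg'.integrable.integrableOn hg.integrable.integrableOn]
    simp only [labelOf]; ring
  rw [this, abs_neg, ← Real.norm_eq_abs]
  exact (norm_integral_le_integral_norm _).trans
    (setIntegral_le_integral (hg'.integrable.sub hg.integrable).norm
      (Eventually.of_forall fun t => norm_nonneg _))

theorem abs_positionOf_sub_positionOf_le (ξ : ℝ) : |positionOf g' ξ - positionOf g ξ| ≤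
    (eLpNorm (fun x => g' x - g x) 1 volume).toReal := by
  refine (hg.abs_sub_le_abs_labelOf_sub _ _).trans ?_
  rw [hg.labelOf_positionOf]
  exact hg.abs_labelOf_positionOf_sub_le hg' ξ

theorem abs_stretchOf_sub_stretchOf_le_one (ξ : ℝ) : |stretchOf g' ξ - stretchOf g ξ| ≤ 1 := by
  have := hg.stretchOf_pos ξ
  have := hg.stretchOf_le_one ξ
  have := hg'.stretchOf_pos ξ
  have := hg'.stretchOf_le_one ξ
  rw [abs_le]; constructor <;> linarith

/-- The difference of inverses is `(g ∘ y - g' ∘ y') q q'`; insert `k` at both positions. Each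
approximation error keeps the stretch belonging to its own position, as the weighted contraction
requires. -/
theorem abs_stretchOf_sub_stretchOf_le (k : ℝ → ℝ) (ξ : ℝ) :
    |stretchOf g' ξ - stretchOf g ξ| ≤
      |(g (positionOf g ξ) - k (positionOf g ξ)) * stretchOf g ξ| +
      |k (positionOf g' ξ) - k (positionOf g ξ)| +
      |(k (positionOf g' ξ) - g' (positionOf g' ξ)) * stretchOf g' ξ| := by
  have hq := hg.stretchOf_pos ξ
  have hq1 := hg.stretchOf_le_one ξ
  have hq' := hg'.stretchOf_pos ξ
  have hq1' := hg'.stretchOf_le_one ξ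
  have h1 := (hg.one_add_pos (positionOf g ξ)).ne'
  have h2 := (hg'.one_add_pos (positionOf g' ξ)).ne'
  set a := g (positionOf g ξ)
  set b := g' (positionOf g' ξ)
  set c := k (positionOf g ξ)
  set d := k (positionOf g' ξ)
  have hid : stretchOf g' ξ - stretchOf g ξ =
      (a - c) * stretchOf g ξ * stretchOf g' ξ - (d - c) * (stretchOf g ξ * stretchOf g' ξ) +
        (d - b) * stretchOf g' ξ * stretchOf g ξ := by
    have e1 : stretchOf g ξ = (1 + a)⁻¹ := rfl
    have e2 : stretchOf g' ξ = (1 + b)⁻¹ := rfl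
    rw [e1, e2]
    field_simp
    ring
  rw [hid]
  refine (abs_add_le _ _).trans (add_le_add ((abs_sub _ _).trans (add_le_add ?_ ?_)) ?_)
  · rw [abs_mul _ (stretchOf g' ξ), abs_of_pos hq']
    exact mul_le_of_le_one_right (abs_nonneg _) hq1'
  · rw [abs_mul, abs_of_pos (mul_pos hq hq')]
    exact mul_le_of_le_one_right (abs_nonneg _) (mul_le_one₀ hq1 hq'.le hq1')
  · rw [abs_mul _ (stretchOf g ξ), abs_of_pos hq]
    exact mul_le_of_le_one_right (abs_nonneg _) hq1

end IsEnergyDensity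

section Convergence

variable {g : ℝ → ℝ} {gs : ℕ → ℝ → ℝ}

theorem tendsto_eLpNorm_comp_positionOf_sub (hg : IsEnergyDensity g)
    (hgs : ∀ n, IsEnergyDensity (gs n))
    (hlim : Tendsto (fun n => eLpNorm (fun x => gs n x - g x) 1 volume) atTop (𝓝 0))
    {k : ℝ → ℝ} (hk : Continuous k) (hkc : HasCompactSupport k) (p : ℝ≥0∞) :
    Tendsto (fun n => eLpNorm (fun ξ => k (positionOf (gs n) ξ) - k (positionOf g ξ)) p volume)
      atTop (𝓝 0) :=
  tendsto_eLpNorm_comp_sub_comp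
    ((ENNReal.tendsto_toReal ENNReal.zero_ne_top).comp hlim)
    (fun n ξ => hg.abs_positionOf_sub_positionOf_le (hgs n) ξ) hg.abs_sub_positionOf_le hk hkc p

theorem tendsto_eLpNorm_one_stretchOf_sub (hg : IsEnergyDensity g)
    (hgs : ∀ n, IsEnergyDensity (gs n))
    (hlim : Tendsto (fun n => eLpNorm (fun x => gs n x - g x) 1 volume) atTop (𝓝 0)) :
    Tendsto (fun n => eLpNorm (fun ξ => stretchOf (gs n) ξ - stretchOf g ξ) 1 volume)
      atTop (𝓝 0) := by
  refine tendsto_zero_of_le_add fun η hη => ?_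
  -- Tolerance `η / 2`, because `‖g - k‖` is paid twice: directly, and inside `‖k - g_n‖ ≤ ‖k - g‖ +
  -- ‖g - g_n‖`.
  obtain ⟨k, hkc, hgk, hk, -⟩ := (memLp_one_iff_integrable.2
    hg.integrable).exists_hasCompactSupport_eLpNorm_sub_le ENNReal.one_ne_top
    (ENNReal.half_pos hη).ne'
  refine ⟨_, tendsto_add_zero hlim (tendsto_eLpNorm_comp_positionOf_sub hg hgs hlim hk hkc 1),
    fun n => ?_⟩
  have hkm := hk.measurable
  have hgk' : eLpNorm (fun x => g x - k x) 1 volume ≤ η / 2 := hgk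
  have hY := hg.measurable_positionOf
  have hYn := (hgs n).measurable_positionOf
  have hA := hg.eLpNorm_comp_mul_stretchOf_le (h := fun x => g x - k x)
    (hg.measurable.sub hkm) le_rfl ENNReal.one_ne_top
  have hC := (hgs n).eLpNorm_comp_mul_stretchOf_le (h := fun x => k x - gs n x)
    (hkm.sub (hgs n).measurable) le_rfl ENNReal.one_ne_top
  have hC' := eLpNorm_sub_le_add (p := 1) le_rfl hkm hg.measurable (hgs n).measurable
  rw [eLpNorm_sub_comm' k g, eLpNorm_sub_comm' g (gs n)] at hC'
  refine (eLpNorm_le_add_add le_rfl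
    (((hg.measurable.sub hkm).comp hY).mul hg.measurable_stretchOf)
    ((hkm.comp hYn).sub (hkm.comp hY))
    (((hkm.sub (hgs n).measurable).comp hYn).mul (hgs n).measurable_stretchOf)
    (hg.abs_stretchOf_sub_stretchOf_le (hgs n) k)).trans ?_
  refine (add_le_add (add_le_add (hA.trans hgk') le_rfl)
    (hC.trans (hC'.trans (add_le_add_left hgk' _)))).trans (le_of_eq ?_)
  nth_rewrite 3 [← ENNReal.add_halves η]
  have e : k ∘ positionOf (gs n) - k ∘ positionOf g =
    fun ξ => k (positionOf (gs n) ξ) - k (positionOf g ξ) := rfl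
  rw [e]
  ring

theorem tendsto_eLpNorm_two_stretchOf_sub (hg : IsEnergyDensity g)
    (hgs : ∀ n, IsEnergyDensity (gs n))
    (hlim : Tendsto (fun n => eLpNorm (fun x => gs n x - g x) 1 volume) atTop (𝓝 0)) :
    Tendsto (fun n => eLpNorm (fun ξ => stretchOf (gs n) ξ - stretchOf g ξ) 2 volume)
      atTop (𝓝 0) :=
  tendsto_zero_of_sq (tendsto_of_tendsto_of_tendsto_of_le_of_le tendsto_const_nhds
    (tendsto_eLpNorm_one_stretchOf_sub hg hgs hlim) (fun _ => zero_le)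
    fun n => eLpNorm_two_sq_le_eLpNorm_one (hg.abs_stretchOf_sub_stretchOf_le_one (hgs n)))

/-- The same density argument in `L²`. In the middle term both factors move: `k` along the
positions, which converge uniformly, and the stretch, multiplied by the bounded `k`. -/
theorem tendsto_eLpNorm_two_comp_mul_stretchOf_sub (hg : IsEnergyDensity g)
    (hgs : ∀ n, IsEnergyDensity (gs n))
    (hlim : Tendsto (fun n => eLpNorm (fun x => gs n x - g x) 1 volume) atTop (𝓝 0))
    {w : ℝ → ℝ} {ws : ℕ → ℝ → ℝ} (hw : Measurable w) (hw2 : MemLp w 2 volume)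
    (hws : ∀ n, Measurable (ws n))
    (hwlim : Tendsto (fun n => eLpNorm (fun x => ws n x - w x) 2 volume) atTop (𝓝 0)) :
    Tendsto (fun n => eLpNorm (fun ξ => ws n (positionOf (gs n) ξ) * stretchOf (gs n) ξ -
      w (positionOf g ξ) * stretchOf g ξ) 2 volume) atTop (𝓝 0) := by
  refine tendsto_zero_of_le_add fun η hη => ?_
  obtain ⟨k, hkc, hwk, hk, -⟩ := hw2.exists_hasCompactSupport_eLpNorm_sub_le
    ENNReal.ofNat_ne_top (ENNReal.half_pos hη).ne'
  obtain ⟨K, hK⟩ := hkc.exists_bound_of_continuous hk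
  have hK0 : 0 ≤ K := (norm_nonneg _).trans (hK 0)
  refine ⟨_, tendsto_add_zero hwlim (tendsto_add_zero
    (tendsto_eLpNorm_comp_positionOf_sub hg hgs hlim hk hkc 2)
    (tendsto_const_mul_zero (c := ENNReal.ofReal K)
      (tendsto_eLpNorm_two_stretchOf_sub hg hgs hlim) ENNReal.ofReal_ne_top)), fun n => ?_⟩
  have hkm := hk.measurable
  have hwk' : eLpNorm (fun x => w x - k x) 2 volume ≤ η / 2 := hwk
  have hY := hg.measurable_positionOf
  have hYn := (hgs n).measurable_positionOf
  have hq := hg.measurable_stretchOf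
  have hqn := (hgs n).measurable_stretchOf
  have hA := (hgs n).eLpNorm_comp_mul_stretchOf_le (h := fun x => ws n x - k x)
    ((hws n).sub hkm) one_le_two ENNReal.ofNat_ne_top
  have hC := hg.eLpNorm_comp_mul_stretchOf_le (h := fun x => w x - k x)
    (hw.sub hkm) one_le_two ENNReal.ofNat_ne_top
  have hA' := eLpNorm_sub_le_add (p := 2) one_le_two (hws n) hw hkm
  have hB : eLpNorm (fun ξ => k (positionOf (gs n) ξ) * stretchOf (gs n) ξ -
      k (positionOf g ξ) * stretchOf g ξ) 2 volume ≤
      eLpNorm (fun ξ => k (positionOf (gs n) ξ) - k (positionOf g ξ)) 2 volume +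
        ENNReal.ofReal K * eLpNorm (fun ξ => stretchOf (gs n) ξ - stretchOf g ξ) 2 volume := by
    have h1 : eLpNorm (fun ξ => K * (stretchOf (gs n) ξ - stretchOf g ξ)) 2 volume =
        ENNReal.ofReal K * eLpNorm (fun ξ => stretchOf (gs n) ξ - stretchOf g ξ) 2 volume := by
      have := eLpNorm_const_smul (p := 2) (μ := (volume : Measure ℝ)) K
        (fun ξ => stretchOf (gs n) ξ - stretchOf g ξ)
      rw [Real.enorm_eq_ofReal hK0] at this
      exact this
    have h2 := eLpNorm_le_add_add (p := 2) one_le_two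
      (f := fun ξ => k (positionOf (gs n) ξ) * stretchOf (gs n) ξ -
        k (positionOf g ξ) * stretchOf g ξ)
      ((hkm.comp hYn).sub (hkm.comp hY)) ((hqn.sub hq).const_mul K)
      (measurable_const (a := (0 : ℝ))) (fun ξ => by
        have e : k (positionOf (gs n) ξ) * stretchOf (gs n) ξ -
            k (positionOf g ξ) * stretchOf g ξ =
            (k (positionOf (gs n) ξ) - k (positionOf g ξ)) * stretchOf g ξ +
              k (positionOf (gs n) ξ) * (stretchOf (gs n) ξ - stretchOf g ξ) := by ring
        simp only [Pi.sub_apply, Function.comp_apply, abs_zero, add_zero]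
        rw [e]
        refine (abs_add_le _ _).trans (add_le_add ?_ ?_)
        · rw [abs_mul, abs_of_pos (hg.stretchOf_pos ξ)]
          exact mul_le_of_le_one_right (abs_nonneg _) (hg.stretchOf_le_one ξ)
        · rw [abs_mul, abs_mul, abs_of_nonneg hK0]
          exact mul_le_mul_of_nonneg_right (hK _) (abs_nonneg _))
    rw [eLpNorm_zero', add_zero] at h2
    exact h2.trans (add_le_add le_rfl h1.le)
  refine (eLpNorm_le_add_add one_le_two
    ((((hws n).sub hkm).comp hYn).mul hqn)
    (((hkm.comp hYn).mul hqn).sub ((hkm.comp hY).mul hq))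
    (((hw.sub hkm).comp hY).mul hq) (fun ξ => ?_)).trans ?_
  · have e : ws n (positionOf (gs n) ξ) * stretchOf (gs n) ξ - w (positionOf g ξ) * stretchOf g ξ =
        (ws n (positionOf (gs n) ξ) - k (positionOf (gs n) ξ)) * stretchOf (gs n) ξ +
        (k (positionOf (gs n) ξ) * stretchOf (gs n) ξ - k (positionOf g ξ) * stretchOf g ξ) -
        (w (positionOf g ξ) - k (positionOf g ξ)) * stretchOf g ξ := by ring
    rw [e]
    exact (abs_sub _ _).trans (add_le_add (abs_add_le _ _) le_rfl)
  refine (add_le_add (add_le_add (hA.trans (hA'.trans (add_le_add_right hwk' _))) hB)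
    (hC.trans hwk')).trans (le_of_eq ?_)
  nth_rewrite 3 [← ENNReal.add_halves η]
  ring

end Convergence

/-! ### From convergence in `H¹` to convergence in `E` -/

theorem MemH1.sub {f g : ℝ → ℝ} (hf : MemH1 f) (hg : MemH1 g) : MemH1 fun x => f x - g x := by
  obtain ⟨hfc, hf2, f', hf', hf'2⟩ := hf
  obtain ⟨hgc, hg2, g', hg', hg'2⟩ := hg
  exact ⟨hfc.sub hgc, hf2.sub hg2, _, hf'.sub hg', hf'2.sub hg'2⟩

theorem MemV.sub {f g : ℝ → ℝ} (hf : MemV f) (hg : MemV g) : MemV fun x => f x - g x := by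
  obtain ⟨hfc, hf2, f', hf', hf'2⟩ := hf
  obtain ⟨hgc, hg2, g', hg', hg'2⟩ := hg
  exact ⟨hfc.sub hgc, hf2.sub hg2, _, hf'.sub hg', hf'2.sub hg'2⟩

theorem MemH1.h1Norm_eq {f w : ℝ → ℝ} (hf : MemH1 f) (hw : HasWeakDeriv f w) :
    h1Norm f = (eLpNorm f 2 volume ^ 2 + eLpNorm w 2 volume ^ 2) ^ (1 / 2 : ℝ) := by
  rw [h1Norm, if_pos hf, eLpNorm_congr_ae hw.weakDeriv_ae_eq]

theorem MemV.vNorm_le {f w : ℝ → ℝ} (hf : MemV f) (hw : HasWeakDeriv f w) {C : ℝ≥0∞}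
    (hC : ∀ x, ‖f x‖ₑ ≤ C) : vNorm f ≤ C + eLpNorm w 2 volume := by
  rw [vNorm, if_pos hf, eLpNorm_congr_ae hw.weakDeriv_ae_eq, eLpNorm_exponent_top]
  gcongr
  exact eLpNormEssSup_le_of_ae_enorm_bound (Eventually.of_forall hC)

theorem tendsto_h1Norm_zero_iff {f w : ℕ → ℝ → ℝ} (hf : ∀ n, MemH1 (f n))
    (hw : ∀ n, HasWeakDeriv (f n) (w n)) :
    Tendsto (fun n => h1Norm (f n)) atTop (𝓝 0) ↔
      Tendsto (fun n => eLpNorm (f n) 2 volume) atTop (𝓝 0) ∧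
        Tendsto (fun n => eLpNorm (w n) 2 volume) atTop (𝓝 0) := by
  have hsq : ∀ n, h1Norm (f n) ^ 2 = eLpNorm (f n) 2 volume ^ 2 + eLpNorm (w n) 2 volume ^ 2 :=
    fun n => by
      rw [(hf n).h1Norm_eq (hw n), ← ENNReal.rpow_natCast, ← ENNReal.rpow_mul]
      norm_num
  constructor
  · intro h
    have h2 := tendsto_sq_zero h
    simp only [hsq] at h2
    exact ⟨tendsto_zero_of_sq (tendsto_of_tendsto_of_tendsto_of_le_of_le tendsto_const_nhds h2
        (fun _ => zero_le) fun _ => le_self_add),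
      tendsto_zero_of_sq (tendsto_of_tendsto_of_tendsto_of_le_of_le tendsto_const_nhds h2
        (fun _ => zero_le) fun _ => le_add_self)⟩
  · rintro ⟨h1, h2⟩
    refine tendsto_zero_of_sq ?_
    simp only [hsq]
    exact tendsto_add_zero (tendsto_sq_zero h1) (tendsto_sq_zero h2)

theorem IsH1Pair.sub {u w v z : ℝ → ℝ} (h : IsH1Pair u w) (h' : IsH1Pair v z) :
    IsH1Pair (fun x => u x - v x) (fun x => w x - z x) :=
  ⟨h.continuous.sub h'.continuous, h.measurable.sub h'.measurable,
    h.hasWeakDeriv.sub h'.hasWeakDeriv, h.memLp.sub h'.memLp, h.memLp_deriv.sub h'.memLp_deriv⟩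

theorem IsH1Pair.memH1 {u w : ℝ → ℝ} (h : IsH1Pair u w) : MemH1 u :=
  ⟨h.continuous, h.memLp, w, h.hasWeakDeriv, h.memLp_deriv⟩

theorem tendsto_eLpNorm_one_sq_sub_sq {f : ℝ → ℝ} {fs : ℕ → ℝ → ℝ} (hf : Measurable f)
    (hf2 : MemLp f 2 volume) (hfs : ∀ n, Measurable (fs n))
    (hlim : Tendsto (fun n => eLpNorm (fun x => fs n x - f x) 2 volume) atTop (𝓝 0)) :
    Tendsto (fun n => eLpNorm (fun x => fs n x ^ 2 - f x ^ 2) 1 volume) atTop (𝓝 0) := by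
  refine tendsto_of_tendsto_of_tendsto_of_le_of_le tendsto_const_nhds ?_ (fun _ => zero_le)
    fun n => eLpNorm_one_sq_sub_sq_le (hfs n) hf
  have hc : eLpNorm f 2 volume + eLpNorm f 2 volume ≠ ⊤ :=
    ENNReal.add_ne_top.2 ⟨hf2.eLpNorm_ne_top, hf2.eLpNorm_ne_top⟩
  have h := tendsto_add_zero (tendsto_sq_zero hlim) (tendsto_const_mul_zero hlim hc)
  refine h.congr fun n => ?_
  ring

section Convergence

variable {v z : ℝ → ℝ} {u w : ℕ → ℝ → ℝ}

theorem tendsto_eLpNorm_energyDensity_sub (h : IsH1Pair v z) (hs : ∀ n, IsH1Pair (u n) (w n))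
    (hu : Tendsto (fun n => eLpNorm (fun x => u n x - v x) 2 volume) atTop (𝓝 0))
    (hw : Tendsto (fun n => eLpNorm (fun x => w n x - z x) 2 volume) atTop (𝓝 0)) :
    Tendsto (fun n => eLpNorm (fun x => energyDensity (u n) (w n) x - energyDensity v z x) 1
      volume) atTop (𝓝 0) := by
  have h1 := tendsto_eLpNorm_one_sq_sub_sq h.continuous.measurable h.memLp
    (fun n => (hs n).continuous.measurable) hu
  have h2 := tendsto_eLpNorm_one_sq_sub_sq h.measurable h.memLp_deriv
    (fun n => (hs n).measurable) hw
  refine tendsto_of_tendsto_of_tendsto_of_le_of_le tendsto_const_nhds (tendsto_add_zero h1 h2)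
    (fun _ => zero_le) fun n => ?_
  have hm1 : AEStronglyMeasurable (fun x => u n x ^ 2 - v x ^ 2) volume :=
    (((hs n).continuous.pow 2).sub (h.continuous.pow 2)).aestronglyMeasurable
  have hm2 : AEStronglyMeasurable (fun x => w n x ^ 2 - z x ^ 2) volume :=
    (((hs n).measurable.pow_const 2).sub (h.measurable.pow_const 2)).aestronglyMeasurable
  have e : (fun x => energyDensity (u n) (w n) x - energyDensity v z x) =
      (fun x => u n x ^ 2 - v x ^ 2) + fun x => w n x ^ 2 - z x ^ 2 := by
    funext x; simp only [energyDensity, Pi.add_apply]; ring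
  rw [e]
  exact eLpNorm_add_le hm1 hm2 le_rfl

theorem tendsto_eLpNorm_two_comp_positionOf_sub (h : IsH1Pair v z)
    (hs : ∀ n, IsH1Pair (u n) (w n))
    (hu : Tendsto (fun n => eLpNorm (fun x => u n x - v x) 2 volume) atTop (𝓝 0))
    (hw : Tendsto (fun n => eLpNorm (fun x => w n x - z x) 2 volume) atTop (𝓝 0)) :
    Tendsto (fun n => eLpNorm (fun ξ => u n (positionOf (energyDensity (u n) (w n)) ξ) -
      v (positionOf (energyDensity v z) ξ)) 2 volume) atTop (𝓝 0) := by
  have hg := h.isEnergyDensity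
  have hgs := fun n => (hs n).isEnergyDensity
  have hlim := tendsto_eLpNorm_energyDensity_sub h hs hu hw
  have hY := hg.measurable_positionOf
  have hYs := fun n => (hgs n).measurable_positionOf
  have hvm := h.continuous.measurable
  have hum := fun n => (hs n).continuous.measurable
  -- The Sobolev bound for `u n - v` tends to 0 and multiplies total energies that converge to a
  -- finite limit.
  have hfirst : Tendsto (fun n => eLpNorm ((fun x => u n x - v x) ∘
      positionOf (energyDensity (u n) (w n))) 2 volume) atTop (𝓝 0) := by
    refine tendsto_zero_of_sq (tendsto_of_tendsto_of_tendsto_of_le_of_le tendsto_const_nhds ?_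
      (fun _ => zero_le) fun n => (hs n).eLpNorm_comp_positionOf_sq_le ((hum n).sub hvm)
        ((hs n).sub h).sq_le)
    refine tendsto_add_zero (tendsto_sq_zero hu) ?_
    have hC : ∀ n, ENNReal.ofReal (2 * ((∫ x, (u n x - v x) ^ 2) + ∫ x, (w n x - z x) ^ 2)) =
        2 * (eLpNorm (fun x => u n x - v x) 2 volume ^ 2 +
          eLpNorm (fun x => w n x - z x) 2 volume ^ 2) := by
      intro n
      have hd := (hs n).sub h
      rw [ENNReal.ofReal_mul zero_le_two, ENNReal.ofReal_add
        (integral_nonneg fun x => sq_nonneg _) (integral_nonneg fun x => sq_nonneg _),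
        ofReal_integral_eq_lintegral_ofReal hd.memLp.integrable_sq
          (Eventually.of_forall fun x => sq_nonneg _),
        ofReal_integral_eq_lintegral_ofReal hd.memLp_deriv.integrable_sq
          (Eventually.of_forall fun x => sq_nonneg _), eLpNorm_two_sq, eLpNorm_two_sq]
      simp
    have hE : ∀ n, ∫⁻ x, ENNReal.ofReal (energyDensity (u n) (w n) x) ≤
        eLpNorm (fun x => energyDensity (u n) (w n) x - energyDensity v z x) 1 volume +
          eLpNorm (energyDensity v z) 1 volume := by
      intro n
      have := eLpNorm_sub_le_add (p := 1) le_rfl (hgs n).measurable hg.measurable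
        (measurable_const (a := (0 : ℝ)))
      simp only [sub_zero] at this
      refine le_trans (le_of_eq ?_) this
      rw [eLpNorm_one_eq_lintegral_enorm]
      exact lintegral_congr fun x => (Real.enorm_eq_ofReal ((hgs n).nonneg x)).symm
    have hfin : eLpNorm (energyDensity v z) 1 volume ≠ ⊤ :=
      (memLp_one_iff_integrable.2 hg.integrable).eLpNorm_ne_top
    have hClim := tendsto_const_mul_zero (c := 2)
      (tendsto_add_zero (tendsto_sq_zero hu) (tendsto_sq_zero hw)) ENNReal.ofNat_ne_top
    have hprod := ENNReal.Tendsto.mul hClim (Or.inr (by simpa using hfin))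
      (hlim.add_const (eLpNorm (energyDensity v z) 1 volume)) (Or.inr ENNReal.zero_ne_top)
    rw [zero_mul] at hprod
    refine tendsto_of_tendsto_of_tendsto_of_le_of_le tendsto_const_nhds hprod
      (fun _ => zero_le) fun n => ?_
    simp only [hC]
    exact mul_le_mul' le_rfl (hE n)
  -- Here `v ∘ y_n` is written as `(v ∘ y)` after `label ∘ y_n`, a map uniformly close to the
  -- identity, so the displacement estimate applies to `v ∘ y`.
  have hsecond : Tendsto (fun n => eLpNorm (fun ξ =>
      (v ∘ positionOf (energyDensity v z)) (labelOf (energyDensity v z)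
        (positionOf (energyDensity (u n) (w n)) ξ)) -
      (v ∘ positionOf (energyDensity v z)) ξ) 2 volume) atTop (𝓝 0) := by
    refine tendsto_zero_of_sq (tendsto_of_tendsto_of_tendsto_of_le_of_le tendsto_const_nhds ?_
      (fun _ => zero_le) fun n => eLpNorm_comp_sub_self_sq_le h.memH1_comp_positionOf.1
        ((h.measurable.comp hY).mul hg.measurable_stretchOf) h.hasWeakDeriv_comp
        h.memLp_deriv_comp (hg.abs_labelOf_positionOf_sub_le (hgs n)))
    have hr := (ENNReal.tendsto_toReal ENNReal.zero_ne_top).comp hlim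
    have hr2 := ENNReal.tendsto_ofReal ((hr.pow 2).const_mul 2)
    simp only [ENNReal.toReal_zero, ne_eq, OfNat.ofNat_ne_zero, not_false_eq_true, zero_pow,
      mul_zero, ENNReal.ofReal_zero, Function.comp_apply] at hr2
    have hmul := ENNReal.Tendsto.mul_const hr2
      (Or.inr (ENNReal.pow_ne_top h.memLp_deriv_comp.eLpNorm_ne_top (n := 2)))
    rw [zero_mul] at hmul
    exact hmul
  refine tendsto_of_tendsto_of_tendsto_of_le_of_le tendsto_const_nhds
    (tendsto_add_zero hfirst hsecond) (fun _ => zero_le) fun n => ?_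
  have := eLpNorm_sub_le_add (p := 2) one_le_two ((hum n).comp (hYs n)) (hvm.comp (hYs n))
    (hvm.comp hY)
  simp only [Function.comp_apply, hg.positionOf_labelOf] at this ⊢
  exact this

theorem tendsto_distE_lagMap (h : IsH1Pair v z) (hs : ∀ n, IsH1Pair (u n) (w n))
    (hu : Tendsto (fun n => eLpNorm (fun x => u n x - v x) 2 volume) atTop (𝓝 0))
    (hw : Tendsto (fun n => eLpNorm (fun x => w n x - z x) 2 volume) atTop (𝓝 0)) :
    Tendsto (fun n => distE (lagMap (u n, energyMeasure (u n))) (lagMap (v, energyMeasure v)))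
      atTop (𝓝 0) := by
  have hg := h.isEnergyDensity
  have hgs := fun n => (hs n).isEnergyDensity
  have hlim := tendsto_eLpNorm_energyDensity_sub h hs hu hw
  have hq := tendsto_eLpNorm_two_stretchOf_sub hg hgs hlim
  have hbd : ∀ n ξ, ‖positionOf (energyDensity (u n) (w n)) ξ - positionOf (energyDensity v z) ξ‖ₑ ≤
      eLpNorm (fun x => energyDensity (u n) (w n) x - energyDensity v z x) 1 volume := by
    intro n ξ
    rw [← ofReal_norm, Real.norm_eq_abs]
    exact (ENNReal.ofReal_le_ofReal (hg.abs_positionOf_sub_positionOf_le (hgs n) ξ)).trans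
      ENNReal.ofReal_toReal_le
  rw [h.lagMap_eq]
  simp only [fun n => (hs n).lagMap_eq, distE, Lag.zeta]
  refine tendsto_add_zero (tendsto_add_zero ?_ ?_) ?_
  · refine tendsto_of_tendsto_of_tendsto_of_le_of_le tendsto_const_nhds
      (tendsto_add_zero hlim hq) (fun _ => zero_le) fun n => ?_
    refine (((hgs n).memV_zeta.sub hg.memV_zeta).vNorm_le (C := eLpNorm (fun x =>
      energyDensity (u n) (w n) x - energyDensity v z x) 1 volume)
      ((hgs n).hasWeakDeriv_zeta.sub hg.hasWeakDeriv_zeta) fun ξ => ?_).trans (le_of_eq ?_)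
    · rw [sub_sub_sub_cancel_right]; exact hbd n ξ
    · simp only [sub_sub_sub_cancel_right]
  · exact (tendsto_h1Norm_zero_iff
      (fun n => (hs n).memH1_comp_positionOf.sub h.memH1_comp_positionOf)
      (fun n => (hs n).hasWeakDeriv_comp.sub h.hasWeakDeriv_comp)).2
      ⟨tendsto_eLpNorm_two_comp_positionOf_sub h hs hu hw,
        tendsto_eLpNorm_two_comp_mul_stretchOf_sub hg hgs hlim h.measurable h.memLp_deriv
          (fun n => (hs n).measurable) hw⟩
  · refine tendsto_of_tendsto_of_tendsto_of_le_of_le tendsto_const_nhds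
      (tendsto_add_zero hlim hq) (fun _ => zero_le) fun n => ?_
    refine (((hgs n).memV_sub_positionOf.sub hg.memV_sub_positionOf).vNorm_le (C := eLpNorm (fun x =>
      energyDensity (u n) (w n) x - energyDensity v z x) 1 volume)
      ((hgs n).hasWeakDeriv_sub_positionOf.sub hg.hasWeakDeriv_sub_positionOf)
      fun ξ => ?_).trans (le_of_eq ?_)
    · rw [sub_sub_sub_cancel_left, ← enorm_neg, neg_sub]; exact hbd n ξ
    · simp only [sub_sub_sub_cancel_left]
      rw [eLpNorm_sub_comm' (stretchOf (energyDensity v z))]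

end Convergence

/-! ### Comparison of the metric `d` with the `E`-distance -/

theorem dLag_le_distE_add_distE {X Y : Lag} (hX : X ∈ setF 0) (hY : Y ∈ setF 0) :
    dLag X Y ≤ distE X Y + distE X Y := by
  have hJ : J X Y ≤ distE X Y + distE X Y :=
    (iInf₂_le (Homeomorph.refl ℝ) refl_mem_relabelings).trans
      (iInf₂_le (Homeomorph.refl ℝ) refl_mem_relabelings)
  refine le_trans ?_ hJ
  -- The chain has a single step from `X` to `Y`; values beyond index 1 play no role.
  refine (iInf_le _ 1).trans ((iInf_le _ fun n => if n = 0 then X else Y).trans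
    ((iInf_le _ ⟨fun n _ => ?_, rfl, rfl⟩).trans ?_))
  · simp
  · dsimp only
    split_ifs
    exacts [hX, hY]

end CamassaHolm

end

theorem mainTheorem5 :
    (∀ u : ℝ → ℝ, CamassaHolm.MemH1 u →
      (u, CamassaHolm.energyMeasure u) ∈ CamassaHolm.setD ∧
      CamassaHolm.lagMap (u, CamassaHolm.energyMeasure u) ∈ CamassaHolm.setF 0) ∧
    ∀ (u : ℕ → ℝ → ℝ) (v : ℝ → ℝ),
      (∀ n, CamassaHolm.MemH1 (u n)) → CamassaHolm.MemH1 v →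
      Tendsto (fun n => CamassaHolm.h1Norm (fun x => u n x - v x)) atTop (𝓝 0) →
      Tendsto (fun n => CamassaHolm.distE
          (CamassaHolm.lagMap (u n, CamassaHolm.energyMeasure (u n)))
          (CamassaHolm.lagMap (v, CamassaHolm.energyMeasure v))) atTop (𝓝 0) ∧
      Tendsto (fun n => CamassaHolm.dD
          (u n, CamassaHolm.energyMeasure (u n))
          (v, CamassaHolm.energyMeasure v)) atTop (𝓝 0) := by
  refine ⟨fun u hu => ?_, fun u v hu hv hlim => ?_⟩
  · obtain ⟨w, h⟩ := hu.exists_isH1Pair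
    exact ⟨h.mem_setD, h.lagMap_mem_setF⟩
  · choose w hw using fun n => (hu n).exists_isH1Pair
    obtain ⟨z, hz⟩ := hv.exists_isH1Pair
    obtain ⟨h1, h2⟩ := (CamassaHolm.tendsto_h1Norm_zero_iff (fun n => ((hw n).sub hz).memH1)
      (fun n => ((hw n).sub hz).hasWeakDeriv)).1 hlim
    have hE := CamassaHolm.tendsto_distE_lagMap hz hw h1 h2
    exact ⟨hE, tendsto_of_tendsto_of_tendsto_of_le_of_le tendsto_const_nhds
      (CamassaHolm.tendsto_add_zero hE hE) (fun _ => zero_le)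
      fun n => CamassaHolm.dLag_le_distE_add_distE (hw n).lagMap_mem_setF hz.lagMap_mem_setF⟩
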